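/- Definitions. All vectors are in $\mathbb{Q}^n$, and a finite set of vectors is identified with the matrix having these vectors as rows. A matrix with $m$ rows is equimodular if its rows are linearly independent and all its nonzero $m\times m$ minors have the same absolute value, called its equideterminant. A matrix is totally equimodular if every set of linearly independent rows forms an equimodular matrix. A linearly independent set of $0,\pm1$ vectors is called - a te-set if its matrix is totally equimodular, and a tu-set if its matrix is totally unimodular; - a te-lace if it is a te-set, not a tu-set, and all its proper subsets are tu-sets; - a te-interlace if it is a te-set, not a tu-set, and each pair of its vectors is a te-lace; a te-interlace of size $\ell$ is thin if its equideterminant is $2^{\ell-1}$ and thick if it is $2^{\ell}$; - a te-brick if it is a tu-set, a te-lace, a thin te-interlace or a thick te-interlace. Pairwise disjoint te-bricks are mutually-tu if every subset of their union that intersects at least two of them, contains none of those that are te-laces, and contains at most one vector of each of those that are te-interlaces, is a tu-set. Theorem. Let $A\subseteq\mathbb{Q}^n$ be a linearly independent set of $0,\pm1$ vectors. Then $A$ is a te-set if and only if it is a disjoint union of mutually-tu te-bricks. More precisely, $A$ is a te-set if and only if it can be written as a disjoint union $$A = U \sqcup L_1\sqcup\dots\sqcup L_k\sqcup S_1\sqcup\dots\sqcup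 S_s\sqcup T_1\sqcup\dots\sqcup T_t \qquad (k,s,t\ge 0)$$ of mutually-tu te-bricks, where $U$ is a (possibly empty) tu-set, the $L_i$ are te-laces, the $S_i$ are thin te-interlaces and the $T_i$ are thick te-interlaces. Moreover, such a decomposition is unique up to the order of the sets of each type and up to listing each of the sets of size two among the $L_i$ and $S_i$ either as a te-lace or as a thin te-interlace (either choice gives again such a decomposition). -/

import Mathlib

/-- The rows of `M` are linearly independent and all nonzero maximal (row-size) minors have the same
absolute value. The map `f` selects the columns; a non-injective `f` only gives the determinant `0`,
and the order of the columns only affects the sign. -/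
def Matrix.IsEquimodular {m n : Type*} [Fintype m] [DecidableEq m] (M : Matrix m n ℚ) : Prop :=
  LinearIndependent ℚ M.row ∧
    ∃ d : ℚ, ∀ f : m → n, (M.submatrix id f).det = 0 ∨ |(M.submatrix id f).det| = d

/-- `M` is equimodular with equideterminant `d`, i.e. `d` is the absolute value of a
(hence of any) nonzero maximal minor. -/
def Matrix.HasEqdet {m n : Type*} [Fintype m] [DecidableEq m] (M : Matrix m n ℚ) (d : ℚ) : Prop :=
  M.IsEquimodular ∧ ∃ f : m → n, (M.submatrix id f).det ≠ 0 ∧ |(M.submatrix id f).det| = d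

/-- Every set of linearly independent rows of `M` forms an equimodular matrix. -/
def Matrix.IsTotallyEquimodular {m n : Type*} [DecidableEq m] (M : Matrix m n ℚ) : Prop :=
  ∀ s : Finset m, LinearIndependent ℚ (fun i : s => M.row i) →
    (M.submatrix (fun i : s => (i : m)) id).IsEquimodular

section TESets

variable {ι : Type*} [Fintype ι]

/-- The matrix whose rows are the vectors of the finite set `A`. -/
def setMatrix (A : Finset (ι → ℚ)) : Matrix A ι ℚ := Matrix.of fun a j => (a : ι → ℚ) j

/-- `A` is a linearly independent set of `0, 1, -1` vectors. -/
def IsIndepSignSet (A : Finset (ι → ℚ)) : Prop :=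
  LinearIndependent ℚ (fun a : A => (a : ι → ℚ)) ∧
    ∀ a ∈ A, ∀ j, a j = 0 ∨ a j = 1 ∨ a j = -1

/-- Totally equimodular sets. -/
def IsTESet (A : Finset (ι → ℚ)) : Prop :=
  IsIndepSignSet A ∧ (setMatrix A).IsTotallyEquimodular

/-- Totally unimodular sets. -/
def IsTUSet (A : Finset (ι → ℚ)) : Prop :=
  IsIndepSignSet A ∧ (setMatrix A).IsTotallyUnimodular

/-- A te-set that is not a tu-set, all of whose proper subsets are tu-sets. -/
def IsTELace (A : Finset (ι → ℚ)) : Prop :=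
  IsTESet A ∧ ¬ IsTUSet A ∧ ∀ X, X ⊂ A → IsTUSet X

/-- A te-set that is not a tu-set and in which each pair of vectors is a te-lace. -/
def IsTEInterlace (A : Finset (ι → ℚ)) : Prop :=
  IsTESet A ∧ ¬ IsTUSet A ∧ ∀ a ∈ A, ∀ b ∈ A, a ≠ b → IsTELace {a, b}

/-- A te-interlace with `l` vectors and equideterminant `2 ^ (l - 1)`
(a te-interlace is nonempty, so `l - 1` is not truncated). -/
def IsThinTEInterlace (A : Finset (ι → ℚ)) : Prop :=
  IsTEInterlace A ∧ (setMatrix A).HasEqdet (2 ^ (A.card - 1))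

/-- A te-interlace with `l` vectors and equideterminant `2 ^ l`. -/
def IsThickTEInterlace (A : Finset (ι → ℚ)) : Prop :=
  IsTEInterlace A ∧ (setMatrix A).HasEqdet (2 ^ A.card)

/-- te-bricks. -/
def IsTEBrick (A : Finset (ι → ℚ)) : Prop :=
  IsTUSet A ∨ IsTELace A ∨ IsThinTEInterlace A ∨ IsThickTEInterlace A

/-- The members of the family `F` (meant for pairwise disjoint te-bricks) are mutually totally
unimodular: a subset `X` of their union that intersects at least two of them, contains none of the
te-laces of `F`, and has at most one vector in each te-interlace of `F`, is a tu-set. -/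
def MutuallyTU (F : Finset (Finset (ι → ℚ))) : Prop :=
  ∀ X : Finset (ι → ℚ), X ⊆ F.sup id →
    (∃ B ∈ F, ∃ B' ∈ F, B ≠ B' ∧ (X ∩ B).Nonempty ∧ (X ∩ B').Nonempty) →
    (∀ B ∈ F, IsTELace B → ¬ B ⊆ X) →
    (∀ B ∈ F, IsTEInterlace B → (X ∩ B).card ≤ 1) →
    IsTUSet X

/-- `A` is the disjoint union of the mutually-tu te-bricks in the family `F`. -/
def IsMutuallyTUPartition (A : Finset (ι → ℚ)) (F : Finset (Finset (ι → ℚ))) : Prop :=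
  (∀ B ∈ F, IsTEBrick B) ∧ (F : Set (Finset (ι → ℚ))).PairwiseDisjoint id ∧
    F.sup id = A ∧ MutuallyTU F

/-- `A` is the disjoint union of the mutually-tu te-bricks consisting of one (possibly empty) tu-set
`U`, the te-laces in `L`, the thin te-interlaces in `S` and the thick te-interlaces in `T`. The
families `L`, `S`, `T` are disjoint, so that no brick is listed twice. -/
structure IsTEDecomposition (A U : Finset (ι → ℚ)) (L S T : Finset (Finset (ι → ℚ))) : Prop where
  tu : IsTUSet U
  laces : ∀ B ∈ L, IsTELace B
  thin : ∀ B ∈ S, IsThinTEInterlace B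
  thick : ∀ B ∈ T, IsThickTEInterlace B
  disjoint_laces_thin : Disjoint L S
  disjoint_laces_thick : Disjoint L T
  disjoint_thin_thick : Disjoint S T
  pairwiseDisjoint :
    ((insert U (L ∪ S ∪ T) : Finset (Finset (ι → ℚ))) : Set (Finset (ι → ℚ))).PairwiseDisjoint id
  union_eq : (insert U (L ∪ S ∪ T)).sup id = A
  mutuallyTU : MutuallyTU (insert U (L ∪ S ∪ T))

end TESets

/-!
Everything is reduced to the Schur complement: `red n f x` is the vector of `x + span n` that
vanishes on a basis `f` of columns of the rows `n`. If `n` is equimodular, then equimodularity of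
a larger family is a statement about the reductions of the additional rows (`IsEqd.red`,
`IsEqd.of_red`). By Cramer's rule the coefficients of a reduction are quotients of
equideterminants, and in particular reduction preserves divisibility of the entries. This makes
congruences between rows usable: a row congruent modulo `k` to a combination of the other rows
multiplies the equideterminant by at least `k` (`EqdSet.le_div`).

A minimal non-unimodular subset of a te-set, that is, a te-lace, has equideterminant `2`, and its
vectors have an even sum (`IsTELace.evenSum`). The te-laces with two vectors are therefore the
pairs of vectors with equal support, and having equal support is an equivalence relation. A
te-lace with at least three vectors is disjoint from every other te-lace (`IsTELace.disjoint`): if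
not, a pair with minimal union has as te-laces in this union only the two sets and possibly their
symmetric difference, and reduction modulo all but four suitable vectors of the union leaves four
sign vectors that turn out to be dependent (`dependent_of_theta`). So the te-laces with at least
three vectors, the classes with at least two vectors of equal support, and the remaining vectors
partition a te-set, and since every non-unimodular subset contains a te-lace, the parts are
mutually-tu.

That the classes are thin or thick is the hardest part (`eqdSet_two_pow_of_common_support`). By
induction it suffices to show that the proper subsets of a class are thin: then adding two vectors
at once costs what adding them separately does, or twice that (`EqdSet.mul_eq_or`). Two distinct
thick subsets of corank one would give two relations modulo `4` whose combination makes a pair too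
divisible (`not_eqdSet_two_pow_erase`). A single thick subset `Z` of corank one would force the
remaining vector to be, on each basis of columns of `Z`, a combination of `Z` with all
coefficients `± 1/2` (`exists_half_coeff`); exchanging one column of the basis then produces an
entry of absolute value `4` where at most `2` is possible (`not_eqdSet_two_pow_of_insert`).

Conversely, in a union of mutually-tu te-bricks the equideterminant of a subset is the product of
those of its traces on the bricks (`eqdSet_of_partition`). This is proved by splitting off a pair
from a te-lace contained in the subset or the whole trace on a te-interlace; modulo the other rows
the columns of the trace remain, up to sign, columns of the interlace or become zero
(`redSet_col_of_common_support`).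

The decomposition is unique because the te-laces of the whole set are exactly the te-laces of the
decomposition and the pairs in its te-interlaces (`IsTEDecomposition.mem_or_exists`), so that the
non-unimodular bricks are described by the set alone (`IsTEDecomposition.mem_iff`). A set is both
a te-lace and a te-interlace only if it has two vectors, and it is then thin.
-/


/-! ### Minors and Schur reduction -/

namespace Equimod

section Minors

variable {ι m m' p q : Type*} [Fintype m] [DecidableEq m] [Fintype m'] [DecidableEq m']
  [Fintype p] [DecidableEq p] [Fintype q] [DecidableEq q]

/-- The maximal minor of the matrix with rows `v` on the columns selected by `f`. -/
def minor (v : m → ι → ℚ) (f : m → ι) : ℚ :=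
  (Matrix.of fun i j => v i (f j)).det

/-- The family `v` has a nonzero maximal minor, and all its nonzero maximal minors have absolute
value `d`. -/
def IsEqd (v : m → ι → ℚ) (d : ℚ) : Prop :=
  (∃ f, minor v f ≠ 0) ∧ ∀ f, minor v f = 0 ∨ |minor v f| = d

theorem minor_comp_equiv (e : m ≃ m') (v : m' → ι → ℚ) (f : m' → ι) :
    minor (v ∘ e) (f ∘ e) = minor v f :=
  Matrix.det_submatrix_equiv_self e (Matrix.of fun i j => v i (f j))

theorem abs_minor_comp_perm (e : Equiv.Perm m) (v : m → ι → ℚ) (f : m → ι) :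
    |minor v (f ∘ e)| = |minor v f| := by
  have h := Matrix.det_permute' e (Matrix.of fun i j => v i (f j))
  have h2 : minor v (f ∘ e) = ((Equiv.Perm.sign e : ℤ) : ℚ) * minor v f := h
  rw [h2, abs_mul]
  rcases Int.units_eq_one_or (Equiv.Perm.sign e) with h | h <;> simp [h]

theorem IsEqd.comp_equiv {v : m' → ι → ℚ} {d : ℚ} (h : IsEqd v d) (e : m ≃ m') :
    IsEqd (v ∘ e) d := by
  obtain ⟨⟨f, hf⟩, h⟩ := h
  refine ⟨⟨f ∘ e, by rwa [minor_comp_equiv]⟩, fun g => ?_⟩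
  have : g = (g ∘ e.symm) ∘ e := by ext; simp
  rw [this, minor_comp_equiv]
  exact h _

theorem IsEqd.pos {v : m → ι → ℚ} {d : ℚ} (h : IsEqd v d) : 0 < d := by
  obtain ⟨⟨f, hf⟩, h⟩ := h
  rcases h f with h | h
  · exact absurd h hf
  · rw [← h]; exact abs_pos.2 hf

theorem IsEqd.unique {v : m → ι → ℚ} {d d' : ℚ} (h : IsEqd v d) (h' : IsEqd v d') : d = d' := by
  obtain ⟨⟨f, hf⟩, h⟩ := h
  rw [← (h f).resolve_left hf, ← (h'.2 f).resolve_left hf]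

theorem linearIndependent_of_minor_ne_zero {v : m → ι → ℚ} {f : m → ι} (h : minor v f ≠ 0) :
    LinearIndependent ℚ v := by
  have h1 : LinearIndependent ℚ (Matrix.of fun i j => v i (f j)).row :=
    Matrix.linearIndependent_rows_iff_isUnit.2 ((Matrix.isUnit_iff_isUnit_det _).2 h.isUnit)
  exact LinearIndependent.of_comp (LinearMap.funLeft ℚ ℚ f) h1

/-- Linearly independent rows have a nonzero maximal minor. -/
theorem exists_minor_ne_zero [Finite ι] {v : m → ι → ℚ} (h : LinearIndependent ℚ v) :
    ∃ f, minor v f ≠ 0 := by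
  cases nonempty_fintype ι
  classical
  have hr : (Matrix.of v).rank = Fintype.card m :=
    LinearIndependent.rank_matrix (M := Matrix.of v) h
  rw [← Matrix.rank_transpose, Matrix.rank_eq_finrank_span_row] at hr
  obtain ⟨g, hg, -, hli⟩ :=
    Submodule.exists_fun_fin_finrank_span_eq ℚ (Set.range (Matrix.of v).transpose.row)
  choose k hk using hg
  let e : m ≃ Fin _ := Fintype.equivOfCardEq (hr.symm.trans (Fintype.card_fin _).symm)
  refine ⟨k ∘ e, ?_⟩
  have h1 : LinearIndependent ℚ (Matrix.of fun i j => v i (k (e j))).transpose.row := by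
    have h2 : g = fun i => (Matrix.of v).transpose.row (k i) := funext fun i => (hk i).symm
    rw [h2] at hli
    exact hli.comp e e.injective
  have h2 := (Matrix.isUnit_iff_isUnit_det _).1 (Matrix.linearIndependent_rows_iff_isUnit.1 h1)
  rw [Matrix.det_transpose] at h2
  exact h2.ne_zero

theorem IsEqd.linearIndependent {v : m → ι → ℚ} {d : ℚ} (h : IsEqd v d) :
    LinearIndependent ℚ v :=
  linearIndependent_of_minor_ne_zero h.1.choose_spec

/-- Two row blocks and a nonzero minor: after a permutation of the columns the first block has a
nonzero minor on the first columns. -/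
theorem exists_minor_left_ne_zero {n : p → ι → ℚ} {y : q → ι → ℚ} {h : p ⊕ q → ι}
    (hh : minor (Sum.elim n y) h ≠ 0) :
    ∃ e : Equiv.Perm (p ⊕ q), minor n (h ∘ e ∘ Sum.inl) ≠ 0 := by
  have hli : LinearIndependent ℚ (fun i j => Sum.elim n y i (h j)) :=
    linearIndependent_of_minor_ne_zero (f := id) hh
  obtain ⟨s, hs⟩ := exists_minor_ne_zero (hli.comp Sum.inl Sum.inl_injective)
  have hinj : Function.Injective s := by
    intro a b hab
    by_contra hne
    exact hs (Matrix.det_zero_of_column_eq hne fun i => by simp [hab])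
  let e0 := (Equiv.ofInjective (Sum.inl : p → p ⊕ q) Sum.inl_injective).symm.trans
    (Equiv.ofInjective s hinj)
  refine ⟨e0.extendSubtype, ?_⟩
  have key : ∀ i, e0.extendSubtype (Sum.inl i) = s i := fun i => by
    rw [e0.extendSubtype_apply_of_mem (Sum.inl i) ⟨i, rfl⟩]
    have : (Equiv.ofInjective (Sum.inl : p → p ⊕ q) Sum.inl_injective).symm
        ⟨Sum.inl i, ⟨i, rfl⟩⟩ = i := Equiv.ofInjective_symm_apply _ i
    simp [e0, this]
  have : h ∘ e0.extendSubtype ∘ Sum.inl = h ∘ s := funext fun i => congrArg h (key i)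
  rw [this]
  exact hs

/-- Reduction of vectors modulo the rows `n` with respect to the columns `f`: if `minor n f ≠ 0`,
then `red n f x` is the unique vector of `x + span n` that vanishes on the columns `f`. Its entries
form the Schur complement of the block `n`, `f`. -/
noncomputable def red (n : p → ι → ℚ) (f : p → ι) : (ι → ℚ) →ₗ[ℚ] (ι → ℚ) :=
  LinearMap.id - Fintype.linearCombination ℚ n ∘ₗ
    Matrix.vecMulLinear (Matrix.of fun i j => n i (f j))⁻¹ ∘ₗ LinearMap.funLeft ℚ ℚ f

theorem red_eq (n : p → ι → ℚ) (f : p → ι) (x : ι → ℚ) :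
    red n f x = x - ∑ i, Matrix.vecMul (x ∘ f) (Matrix.of fun i j => n i (f j))⁻¹ i • n i := rfl

theorem red_apply (n : p → ι → ℚ) (f : p → ι) (x : ι → ℚ) (j : ι) :
    red n f x j = x j -
      ∑ i, Matrix.vecMul (x ∘ f) (Matrix.of fun i j => n i (f j))⁻¹ i * n i j := by
  simp [red_eq]

variable {n : p → ι → ℚ} {f : p → ι}

theorem isUnit_of_minor_ne_zero (hf : minor n f ≠ 0) :
    IsUnit (Matrix.of fun i j => n i (f j)).det := hf.isUnit

theorem red_apply_col (hf : minor n f ≠ 0) (x : ι → ℚ) (i : p) : red n f x (f i) = 0 := by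
  have h : Matrix.vecMul (Matrix.vecMul (x ∘ f) (Matrix.of fun i j => n i (f j))⁻¹)
      (Matrix.of fun i j => n i (f j)) = x ∘ f := by
    rw [Matrix.vecMul_vecMul, Matrix.nonsing_inv_mul _ (isUnit_of_minor_ne_zero hf),
      Matrix.vecMul_one]
  have h2 := congrFun h i
  rw [red_apply, sub_eq_zero]
  exact h2.symm

theorem sub_red_mem_span (n : p → ι → ℚ) (f : p → ι) (x : ι → ℚ) :
    x - red n f x ∈ Submodule.span ℚ (Set.range n) := by
  rw [red_eq, sub_sub_cancel]
  exact Submodule.sum_mem _ fun i _ => Submodule.smul_mem _ _ (Submodule.subset_span ⟨i, rfl⟩)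

theorem eq_zero_of_mem_span (hf : minor n f ≠ 0) {x : ι → ℚ}
    (hx : x ∈ Submodule.span ℚ (Set.range n)) (h0 : ∀ i, x (f i) = 0) : x = 0 := by
  obtain ⟨c, rfl⟩ := (Submodule.mem_span_range_iff_exists_fun ℚ).1 hx
  have h1 : LinearIndependent ℚ (fun i j => n i (f j)) :=
    linearIndependent_of_minor_ne_zero (f := id) hf
  have h2 := Fintype.linearIndependent_iff.1 h1 c (by
    ext j
    simpa using h0 j)
  simp [h2]

theorem red_unique (hf : minor n f ≠ 0) {x y : ι → ℚ}
    (hy : x - y ∈ Submodule.span ℚ (Set.range n)) (h0 : ∀ i, y (f i) = 0) : y = red n f x := by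
  rw [← sub_eq_zero]
  refine eq_zero_of_mem_span hf ?_ fun i => by simp [h0, red_apply_col hf]
  have := Submodule.sub_mem _ (sub_red_mem_span n f x) hy
  convert this using 1
  abel

theorem red_eq_zero (hf : minor n f ≠ 0) {x : ι → ℚ}
    (hx : x ∈ Submodule.span ℚ (Set.range n)) : red n f x = 0 :=
  (red_unique hf (by simpa using hx) fun _ => rfl).symm

theorem red_comp_perm (hf : minor n f ≠ 0) (e : Equiv.Perm p) : red n (f ∘ e) = red n f := by
  ext1 x
  have hf' : minor n (f ∘ e) ≠ 0 := by rwa [← abs_pos, abs_minor_comp_perm, abs_pos]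
  exact (red_unique hf' (sub_red_mem_span n f x) fun i => red_apply_col hf x _).symm

/-- The determinant formula for the Schur complement. -/
theorem minor_sumElim (hf : minor n f ≠ 0) (y : q → ι → ℚ) (g : q → ι) :
    minor (Sum.elim n y) (Sum.elim f g) = minor n f * minor (red n f ∘ y) g := by
  have hu := isUnit_of_minor_ne_zero hf
  let := Matrix.invertibleOfIsUnitDet _ hu
  have h := Matrix.det_fromBlocks₁₁ (Matrix.of fun i j => n i (f j))
    (Matrix.of fun i j => n i (g j)) (Matrix.of fun i j => y i (f j))
    (Matrix.of fun i j => y i (g j))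
  have h1 : (Matrix.of fun i j => Sum.elim n y i (Sum.elim f g j)) =
      Matrix.fromBlocks (Matrix.of fun i j => n i (f j))
    (Matrix.of fun i j => n i (g j)) (Matrix.of fun i j => y i (f j))
    (Matrix.of fun i j => y i (g j)) := by
    ext (i | i) (j | j) <;> rfl
  rw [minor, h1, h]
  congr 2
  ext i j
  simp only [Matrix.sub_apply, Matrix.of_apply, Function.comp_apply, red_apply,
    Matrix.invOf_eq_nonsing_inv]
  rfl

/-- Schur complements of equimodular families are equimodular, with the quotient as
equideterminant. -/
theorem IsEqd.red {y : q → ι → ℚ} {d d' : ℚ} (hn : IsEqd n d) (h : IsEqd (Sum.elim n y) d')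
    (hf : minor n f ≠ 0) [Finite ι] : IsEqd (red n f ∘ y) (d' / d) := by
  have hd := hn.pos
  have hfd : |minor n f| = d := (hn.2 f).resolve_left hf
  constructor
  · apply exists_minor_ne_zero
    have hli := h.linearIndependent
    rw [linearIndependent_sum] at hli
    obtain ⟨-, h2, h3⟩ := hli
    rw [Fintype.linearIndependent_iff]
    intro c hc
    have hmem : ∑ i, c i • y i ∈ Submodule.span ℚ (Set.range n) := by
      have h4 := sub_red_mem_span n f (∑ i, c i • y i)
      have h5 : Equimod.red n f (∑ i, c i • y i) = 0 := by simpa [map_sum] using hc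
      rwa [h5, sub_zero] at h4
    have hmem2 : ∑ i, c i • y i ∈ Submodule.span ℚ (Set.range y) :=
      Submodule.sum_mem _ fun i _ => Submodule.smul_mem _ _ (Submodule.subset_span ⟨i, rfl⟩)
    exact Fintype.linearIndependent_iff.1 h2 c (Submodule.disjoint_def.1 h3 _ hmem hmem2)
  · intro g
    have h1 := minor_sumElim hf y g
    rcases h.2 (Sum.elim f g) with h2 | h2
    · rw [h1] at h2
      exact Or.inl ((mul_eq_zero.1 h2).resolve_left hf)
    · rw [h1, abs_mul, hfd] at h2
      exact Or.inr (by rw [← h2]; field_simp)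

/-- A converse of `IsEqd.red`. All bases of columns of the first block have to be inspected, since a
given nonzero minor of the union need not extend a given one of the block. -/
theorem IsEqd.of_red [Finite ι] {y : q → ι → ℚ} {d e : ℚ} (hn : IsEqd n d)
    (hli : LinearIndependent ℚ (Sum.elim n y))
    (h : ∀ f, minor n f ≠ 0 → ∀ g, minor (Equimod.red n f ∘ y) g = 0 ∨
      |minor (Equimod.red n f ∘ y) g| = e) :
    IsEqd (Sum.elim n y) (d * e) := by
  refine ⟨exists_minor_ne_zero hli, fun h' => or_iff_not_imp_left.2 fun h0 => ?_⟩
  obtain ⟨σ, hσ⟩ := exists_minor_left_ne_zero h0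
  have h1 : h' ∘ σ = Sum.elim (h' ∘ σ ∘ Sum.inl) (h' ∘ σ ∘ Sum.inr) := by
    ext (i | i) <;> rfl
  rw [← abs_minor_comp_perm σ, h1, minor_sumElim hσ, abs_mul, (hn.2 _).resolve_left hσ]
  congr 1
  refine (h _ hσ _).resolve_left fun h2 => h0 ?_
  rw [← abs_eq_zero, ← abs_minor_comp_perm σ, h1, minor_sumElim hσ, h2]
  simp

/-- Cramer's rule for the coefficients of the reduction with respect to the rows. -/
theorem red_eq_cramer_rows (hf : minor n f ≠ 0) (x : ι → ℚ) :
    red n f x = x - ∑ i, (minor (Function.update n i x) f / minor n f) • n i := by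
  rw [red_eq]
  congr 2
  ext1 i
  congr 1
  rw [eq_div_iff hf]
  set A := Matrix.of fun i j => n i (f j) with hA
  set c := Matrix.vecMul (x ∘ f) A⁻¹ with hc
  have h : Matrix.vecMul c A = x ∘ f := by
    rw [hc, Matrix.vecMul_vecMul, Matrix.nonsing_inv_mul _ (isUnit_of_minor_ne_zero hf),
      Matrix.vecMul_one]
  have h2 := Matrix.det_updateRow_sum A i c
  have h3 : (∑ k, c k • A k) = x ∘ f := by
    rw [← h]; ext j; simp [Matrix.vecMul, dotProduct]
  rw [h3, smul_eq_mul] at h2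
  rw [minor, minor, ← h2]
  congr 1
  ext a b
  by_cases hab : a = i
  · subst hab; simp
  · simp [hab, hA]

/-- Cramer's rule for the coefficients of the reduction with respect to the columns. -/
theorem red_apply_cramer_cols (hf : minor n f ≠ 0) (x : ι → ℚ) (j : ι) :
    red n f x j =
      x j - ∑ i, (minor n (Function.update f i j) / minor n f) * x (f i) := by
  rw [red_apply]
  congr 1
  set A := Matrix.of fun i j => n i (f j) with hA
  set w := Matrix.mulVec A⁻¹ (fun i => n i j) with hw
  have h : Matrix.mulVec A w = fun i => n i j := by
    rw [hw, Matrix.mulVec_mulVec, Matrix.mul_nonsing_inv _ (isUnit_of_minor_ne_zero hf),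
      Matrix.one_mulVec]
  have h1 : ∀ i, minor n (Function.update f i j) / minor n f = w i := by
    intro i
    rw [div_eq_iff hf]
    have h2 := Matrix.det_updateCol_sum A i w
    have h3 : (fun k => ∑ i, w i • A k i) = fun i => n i j := by
      rw [← h]; ext k; simp [Matrix.mulVec, dotProduct, mul_comm]
    rw [h3, smul_eq_mul] at h2
    rw [minor, minor, ← h2]
    congr 1
    ext a b
    by_cases hab : b = i
    · subst hab; simp
    · simp [hab, hA]
  simp_rw [h1]
  have h4 := Matrix.dotProduct_mulVec (x ∘ f) A⁻¹ (fun i => n i j)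
  simp only [dotProduct] at h4
  rw [← h4]
  exact Finset.sum_congr rfl fun i _ => mul_comm _ _

/-- Reduction in two steps. -/
theorem red_sumElim_unit {u : ι → ℚ} {k : ι} (hf : minor n f ≠ 0)
    (hu : red n f u k ≠ 0) (x : ι → ℚ) :
    red (Sum.elim n fun _ : Unit => u) (Sum.elim f fun _ => k) x =
      red n f x - (red n f x k / red n f u k) • red n f u := by
  have h0 : minor (Sum.elim n fun _ : Unit => u) (Sum.elim f fun _ => k) ≠ 0 := by
    rw [minor_sumElim hf]
    refine mul_ne_zero hf ?_
    simpa [minor] using hu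
  symm
  apply red_unique h0
  · have hle : Submodule.span ℚ (Set.range n) ≤
        Submodule.span ℚ (Set.range (Sum.elim n fun _ : Unit => u)) :=
      Submodule.span_mono (by rintro _ ⟨i, rfl⟩; exact ⟨Sum.inl i, rfl⟩)
    have h1 := hle (sub_red_mem_span n f x)
    have h2 := hle (sub_red_mem_span n f u)
    have h3 : u ∈ Submodule.span ℚ (Set.range (Sum.elim n fun _ : Unit => u)) :=
      Submodule.subset_span ⟨Sum.inr (), rfl⟩
    have h4 := Submodule.add_mem _ h1 (Submodule.smul_mem _ (red n f x k / red n f u k)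
      (Submodule.sub_mem _ h3 h2))
    convert h4 using 1
    module
  · rintro (i | i)
    · simp [red_apply_col hf]
    · simp [hu]

end Minors
end Equimod

/-! ### Equimodular finite sets of rows -/

namespace Equimod

section Finsets

theorem minor_unit {ι : Type*} (v : Unit → ι → ℚ) (g : Unit → ι) : minor v g = v () (g ()) := by
  simp [minor]

theorem minor_fin_two {ι : Type*} (v : Fin 2 → ι → ℚ) (g : Fin 2 → ι) :
    minor v g = v 0 (g 0) * v 1 (g 1) - v 0 (g 1) * v 1 (g 0) := by
  simp [minor, Matrix.det_fin_two]

variable {ι : Type*} [Fintype ι]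

/-- `IsEqd` for the vectors of a finite set: the set is equimodular with equideterminant `d`. -/
def EqdSet (X : Finset (ι → ℚ)) (d : ℚ) : Prop := IsEqd (Subtype.val : X → ι → ℚ) d

/-- The columns `f` form a basis of the linearly independent rows `N`. -/
def IsBase (N : Finset (ι → ℚ)) (f : N → ι) : Prop := minor (Subtype.val : N → ι → ℚ) f ≠ 0

/-- Reduction modulo a finite set of rows. -/
noncomputable def redSet (N : Finset (ι → ℚ)) (f : N → ι) : (ι → ℚ) →ₗ[ℚ] (ι → ℚ) :=
  red (Subtype.val : N → ι → ℚ) f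

theorem eqdSet_iff_of_mem_iff {m : Type*} [Fintype m] [DecidableEq m] {v : m → ι → ℚ}
    (hv : Function.Injective v) {X : Finset (ι → ℚ)} (hX : ∀ x, x ∈ X ↔ ∃ i, v i = x) {d : ℚ} :
    EqdSet X d ↔ IsEqd v d := by
  let e : m ≃ X := Equiv.ofBijective (fun i => ⟨v i, (hX _).2 ⟨i, rfl⟩⟩)
    ⟨fun i j h => hv (congrArg Subtype.val h), fun ⟨x, hx⟩ => by
      obtain ⟨i, rfl⟩ := (hX x).1 hx
      exact ⟨i, rfl⟩⟩
  constructor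
  · intro h
    exact h.comp_equiv e
  · intro h
    have h1 := h.comp_equiv e.symm
    have h2 : v ∘ e.symm = (Subtype.val : X → ι → ℚ) := by
      ext1 x
      obtain ⟨i, rfl⟩ := e.surjective x
      simp only [Function.comp_apply, Equiv.symm_apply_apply]
      rfl
    rwa [h2] at h1

theorem eqdSet_union {N I : Finset (ι → ℚ)} (h : Disjoint N I) {d : ℚ} :
    EqdSet (N ∪ I) d ↔
      IsEqd (Sum.elim (Subtype.val : N → ι → ℚ) (Subtype.val : I → ι → ℚ)) d := by
  refine eqdSet_iff_of_mem_iff ?_ fun x => ?_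
  · refine Subtype.val_injective.sumElim Subtype.val_injective fun a b hab => ?_
    exact Finset.disjoint_left.1 h a.2 (by rw [hab]; exact b.2)
  · simp

theorem eqdSet_insert {N : Finset (ι → ℚ)} {x : ι → ℚ} (hx : x ∉ N) {d : ℚ} :
    EqdSet (insert x N) d ↔
      IsEqd (Sum.elim (Subtype.val : N → ι → ℚ) fun _ : Unit => x) d := by
  refine eqdSet_iff_of_mem_iff ?_ fun y => ?_
  · refine Subtype.val_injective.sumElim (fun _ _ _ => rfl) fun a b hab => hx ?_
    rw [← hab]; exact a.2
  · simp [or_comm, eq_comm]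

theorem eqdSet_insert_insert {N : Finset (ι → ℚ)} {x y : ι → ℚ} (hx : x ∉ N) (hy : y ∉ N)
    (hxy : x ≠ y) {d : ℚ} :
    EqdSet (insert x (insert y N)) d ↔
      IsEqd (Sum.elim (Subtype.val : N → ι → ℚ) ![x, y]) d := by
  refine eqdSet_iff_of_mem_iff ?_ fun z => ?_
  · refine Subtype.val_injective.sumElim ?_ fun a b hab => ?_
    · intro i j
      fin_cases i <;> fin_cases j <;> simp [hxy, hxy.symm]
    · fin_cases b
      · exact hx (by rw [← show (a : ι → ℚ) = x from hab]; exact a.2)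
      · exact hy (by rw [← show (a : ι → ℚ) = y from hab]; exact a.2)
  · simp [or_comm, or_assoc, eq_comm]

theorem EqdSet.unique {X : Finset (ι → ℚ)} {d d' : ℚ} (h : EqdSet X d) (h' : EqdSet X d') :
    d = d' := IsEqd.unique h h'

theorem EqdSet.pos {X : Finset (ι → ℚ)} {d : ℚ} (h : EqdSet X d) : 0 < d := IsEqd.pos h

theorem EqdSet.exists_isBase {X : Finset (ι → ℚ)} {d : ℚ} (h : EqdSet X d) :
    ∃ f, IsBase X f := h.1

theorem eqdSet_empty : EqdSet (∅ : Finset (ι → ℚ)) 1 := by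
  have h : ∀ f, minor (Subtype.val : (∅ : Finset (ι → ℚ)) → ι → ℚ) f = 1 := fun f =>
    Matrix.det_isEmpty
  exact ⟨⟨fun x => absurd x.2 (Finset.notMem_empty _), by simp [h]⟩, fun f => by simp [h]⟩

variable {N : Finset (ι → ℚ)} {f : N → ι}

theorem redSet_unique (hf : IsBase N f) {x y : ι → ℚ}
    (hy : x - y ∈ Submodule.span ℚ (N : Set (ι → ℚ))) (h0 : ∀ i, y (f i) = 0) :
    y = redSet N f x :=
  red_unique hf (by simpa using hy) h0

theorem redSet_eq_zero (hf : IsBase N f) {x : ι → ℚ}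
    (hx : x ∈ Submodule.span ℚ (N : Set (ι → ℚ))) : redSet N f x = 0 :=
  red_eq_zero hf (by simpa using hx)

theorem redSet_of_mem (hf : IsBase N f) {x : ι → ℚ} (hx : x ∈ N) : redSet N f x = 0 :=
  redSet_eq_zero hf (Submodule.subset_span hx)

theorem redSet_congr (hf : IsBase N f) {x y : ι → ℚ}
    (h : x - y ∈ Submodule.span ℚ (N : Set (ι → ℚ))) : redSet N f x = redSet N f y := by
  rw [← sub_eq_zero, ← map_sub]
  exact redSet_eq_zero hf h

theorem redSet_apply_col (hf : IsBase N f) (x : ι → ℚ) (i : N) : redSet N f x (f i) = 0 :=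
  red_apply_col hf x i

theorem sub_redSet_mem_span (f : N → ι) (x : ι → ℚ) :
    x - redSet N f x ∈ Submodule.span ℚ (N : Set (ι → ℚ)) := by
  simpa [redSet] using sub_red_mem_span (Subtype.val : N → ι → ℚ) f x

/-- The reductions of one more vector have entries `0` or `± d' / d`. -/
theorem EqdSet.redSet_entry {x : ι → ℚ} {d d' : ℚ} (hN : EqdSet N d) (hx : x ∉ N)
    (h : EqdSet (insert x N) d') (hf : IsBase N f) :
    (∀ j, redSet N f x j = 0 ∨ |redSet N f x j| = d' / d) ∧ ∃ j, redSet N f x j ≠ 0 := by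
  obtain ⟨⟨g, hg⟩, h2⟩ := IsEqd.red hN ((eqdSet_insert hx).1 h) hf
  refine ⟨fun j => ?_, g (), by simpa [minor_unit, redSet] using hg⟩
  simpa [minor_unit, redSet] using h2 fun _ => j

/-- The reductions of two more vectors have `2 × 2` minors `0` or `± d' / d`. -/
theorem EqdSet.redSet_pair {x y : ι → ℚ} {d d' : ℚ} (hN : EqdSet N d) (hx : x ∉ N) (hy : y ∉ N)
    (hxy : x ≠ y) (h : EqdSet (insert x (insert y N)) d') (hf : IsBase N f) :
    (∀ j k, redSet N f x j * redSet N f y k - redSet N f x k * redSet N f y j = 0 ∨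
      |redSet N f x j * redSet N f y k - redSet N f x k * redSet N f y j| = d' / d) ∧
    ∃ j k, redSet N f x j * redSet N f y k - redSet N f x k * redSet N f y j ≠ 0 := by
  obtain ⟨⟨g, hg⟩, h2⟩ := IsEqd.red hN ((eqdSet_insert_insert hx hy hxy).1 h) hf
  refine ⟨fun j k => ?_, g 0, g 1, by simpa [minor_fin_two, redSet] using hg⟩
  simpa [minor_fin_two, redSet] using h2 ![j, k]

/-- Cramer's rule: the coefficients of a vector in its reduction are quotients of
equideterminants. -/
theorem EqdSet.exists_row_coeff {d : ℚ} (hN : EqdSet N d) (hf : IsBase N f) {x : ι → ℚ}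
    (hx : x ∉ N) :
    ∃ c : (ι → ℚ) → ℚ, redSet N f x = x - ∑ r ∈ N, c r • r ∧
      ∀ r ∈ N, ∀ d', EqdSet (insert x (N.erase r)) d' → c r = 0 ∨ |c r| = d' / d := by
  have h := red_eq_cramer_rows hf x
  refine ⟨fun r => if hr : r ∈ N then
    minor (Function.update (Subtype.val : N → ι → ℚ) ⟨r, hr⟩ x) f /
      minor (Subtype.val : N → ι → ℚ) f else 0, ?_, ?_⟩
  · rw [redSet, h, ← Finset.sum_attach N]
    congr 1
    refine Finset.sum_congr rfl fun r _ => ?_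
    simp
  · intro r hr d' hd'
    simp only [hr, dite_true]
    have hd : |minor (Subtype.val : N → ι → ℚ) f| = d := (hN.2 f).resolve_left hf
    have h1 : IsEqd (Function.update (Subtype.val : N → ι → ℚ) ⟨r, hr⟩ x) d' := by
      refine (eqdSet_iff_of_mem_iff ?_ fun y => ?_).1 hd'
      · intro a b hab
        by_cases ha : a = ⟨r, hr⟩ <;> by_cases hb : b = ⟨r, hr⟩
        · rw [ha, hb]
        · subst ha
          rw [Function.update_self, Function.update_of_ne hb] at hab
          exact absurd (hab ▸ b.2) hx
        · subst hb
          rw [Function.update_self, Function.update_of_ne ha] at hab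
          exact absurd (hab ▸ a.2) hx
        · rw [Function.update_of_ne ha, Function.update_of_ne hb] at hab
          exact Subtype.ext hab
      · constructor
        · intro hy
          rcases Finset.mem_insert.1 hy with rfl | hy
          · exact ⟨⟨r, hr⟩, by simp⟩
          · obtain ⟨hne, hy⟩ := Finset.mem_erase.1 hy
            exact ⟨⟨y, hy⟩, by rw [Function.update_of_ne (by simpa using hne)]⟩
        · rintro ⟨i, rfl⟩
          by_cases hi : i = ⟨r, hr⟩
          · subst hi; simp
          · rw [Function.update_of_ne hi]
            refine Finset.mem_insert_of_mem (Finset.mem_erase.2 ⟨fun h => hi (Subtype.ext h), i.2⟩)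
    rcases h1.2 f with h2 | h2
    · left; rw [h2, zero_div]
    · right; rw [abs_div, h2, hd]

/-- In an equimodular set the columns have coefficients `0, 1, -1` with respect to a basis of
columns. -/
theorem EqdSet.exists_col_coeff {d : ℚ} (hN : EqdSet N d) (hf : IsBase N f) :
    ∃ w : N → ι → ℚ, (∀ i j, w i j = 0 ∨ w i j = 1 ∨ w i j = -1) ∧
      ∀ x j, redSet N f x j = x j - ∑ i, w i j * x (f i) := by
  refine ⟨fun i j => minor (Subtype.val : N → ι → ℚ) (Function.update f i j) /
    minor (Subtype.val : N → ι → ℚ) f, fun i j => ?_, fun x j => red_apply_cramer_cols hf x j⟩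
  have hd : |minor (Subtype.val : N → ι → ℚ) f| = d := (hN.2 f).resolve_left hf
  rcases hN.2 (Function.update f i j) with h | h
  · left; simp [h]
  · right
    rw [← hd] at h
    rcases abs_eq_abs.1 h with h | h
    · left; simp only [h, div_self hf]
    · right; simp only [h, neg_div, div_self hf]

/-- Reduction modulo an equimodular set preserves divisibility. -/
theorem EqdSet.redSet_mem_zmultiples {d : ℚ} (hN : EqdSet N d) (hf : IsBase N f) {k : ℚ}
    {x : ι → ℚ} (hx : ∀ j, x j ∈ AddSubgroup.zmultiples k) (j : ι) :
    redSet N f x j ∈ AddSubgroup.zmultiples k := by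
  obtain ⟨w, hw, h⟩ := hN.exists_col_coeff hf
  rw [h]
  refine sub_mem (hx j) (sum_mem fun i _ => ?_)
  rcases hw i j with h | h | h <;> simp only [h, zero_mul, one_mul, neg_mul, zero_mem, hx, neg_mem]

theorem le_abs_of_mem_zmultiples {k x : ℚ} (hx : x ∈ AddSubgroup.zmultiples k) (h0 : x ≠ 0) :
    |k| ≤ |x| := by
  obtain ⟨z, rfl⟩ := AddSubgroup.mem_zmultiples_iff.1 hx
  have hz : z ≠ 0 := by rintro rfl; simp at h0
  have h1 : (1 : ℚ) ≤ |(z : ℚ)| := by exact_mod_cast Int.one_le_abs hz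
  rw [zsmul_eq_mul, abs_mul]
  nlinarith [abs_nonneg k]

/-- If `s` is congruent modulo `span N` to a vector with entries divisible by `k`, then adding `s`
multiplies the equideterminant by at least `k`. -/
theorem EqdSet.le_div {d d' k : ℚ} {s v : ι → ℚ} (hN : EqdSet N d) (hs : s ∉ N)
    (h : EqdSet (insert s N) d') (hv : ∀ j, v j ∈ AddSubgroup.zmultiples k)
    (hsv : s - v ∈ Submodule.span ℚ (N : Set (ι → ℚ))) : k ≤ d' / d := by
  obtain ⟨f, hf⟩ := hN.exists_isBase
  obtain ⟨h1, j, hj⟩ := hN.redSet_entry hs h hf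
  have h2 := hN.redSet_mem_zmultiples hf hv j
  rw [← redSet_congr hf hsv] at h2
  rw [← (h1 j).resolve_left hj]
  exact (le_abs_self k).trans (le_abs_of_mem_zmultiples h2 hj)

/-- Adding two vectors, together or separately: the bound behind the fact that minimal
non-unimodular matrices have determinant `± 2`. -/
theorem EqdSet.mul_eq_or {x y : ι → ℚ} {d dx dy dxy : ℚ} (hN : EqdSet N d) (hx : x ∉ N)
    (hy : y ∉ N) (hxy : x ≠ y) (h1 : EqdSet (insert x N) dx) (h2 : EqdSet (insert y N) dy)
    (h : EqdSet (insert x (insert y N)) dxy) : dxy * d = dx * dy ∨ dxy * d = 2 * (dx * dy) := by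
  obtain ⟨f, hf⟩ := hN.exists_isBase
  obtain ⟨ex, -⟩ := hN.redSet_entry hx h1 hf
  obtain ⟨ey, -⟩ := hN.redSet_entry hy h2 hf
  obtain ⟨hm, j, k, hne⟩ := hN.redSet_pair hx hy hxy h hf
  have hm := (hm j k).resolve_left hne
  have hd := hN.pos
  have key : ∀ a b a' b' : ℚ, (a = 0 ∨ |a| = dx / d) → (a' = 0 ∨ |a'| = dx / d) →
      (b = 0 ∨ |b| = dy / d) → (b' = 0 ∨ |b'| = dy / d) → a * b' - a' * b ≠ 0 →
      |a * b' - a' * b| = (dx * dy) / d ^ 2 ∨ |a * b' - a' * b| = 2 * (dx * dy) / d ^ 2 := by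
    have e : ∀ a c : ℚ, 0 ≤ c → (a = 0 ∨ |a| = c) → a = 0 ∨ a = c ∨ a = -c := by
      intro a c hc h
      rcases h with h | h
      · exact Or.inl h
      · exact Or.inr ((abs_eq hc).1 h)
    have px : 0 ≤ dx / d := div_nonneg h1.pos.le hd.le
    have py : 0 ≤ dy / d := div_nonneg h2.pos.le hd.le
    have hc : (dx * dy) / d ^ 2 = dx / d * (dy / d) := by field_simp
    have hc2 : 2 * (dx * dy) / d ^ 2 = 2 * (dx / d * (dy / d)) := by field_simp
    rw [hc, hc2]
    have pp := mul_nonneg px py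
    intro a b a' b' ha ha' hb hb' hne
    rcases e a _ px ha with rfl | rfl | rfl <;> rcases e a' _ px ha' with rfl | rfl | rfl <;>
    rcases e b _ py hb with rfl | rfl | rfl <;> rcases e b' _ py hb' with rfl | rfl | rfl <;>
    first
    | (exfalso; apply hne; ring1)
    | (left; rw [abs_eq pp]; left; ring1)
    | (left; rw [abs_eq pp]; right; ring1)
    | (right; rw [abs_eq (by positivity)]; left; ring1)
    | (right; rw [abs_eq (by positivity)]; right; ring1)
  rcases key _ _ _ _ (ex j) (ex k) (ey j) (ey k) hne with h3 | h3
  · left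
    rw [h3] at hm
    field_simp at hm
    linarith
  · right
    rw [h3] at hm
    field_simp at hm
    linarith

/-- A basis of columns of `insert u N` is a basis of columns of `N` and one further column, and the
reduction can be done in two steps accordingly. -/
theorem IsBase.exists_tower {u : ι → ℚ} (hu : u ∉ N) {f : ↥(insert u N) → ι}
    (hf : IsBase (insert u N) f) :
    ∃ f₀ k, IsBase N f₀ ∧ (∀ i, ∃ i', f₀ i = f i') ∧ (∃ i', k = f i') ∧ redSet N f₀ u k ≠ 0 ∧
      ∀ x, redSet (insert u N) f x =
        redSet N f₀ x - (redSet N f₀ x k / redSet N f₀ u k) • redSet N f₀ u := by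
  let e : N ⊕ Unit ≃ ↥(insert u N) := Equiv.ofBijective
    (Sum.elim (fun i => ⟨i, Finset.mem_insert_of_mem i.2⟩)
      (fun _ => ⟨u, Finset.mem_insert_self _ _⟩)) ⟨by
      refine Function.Injective.sumElim (fun a b h => Subtype.ext (Subtype.mk.inj h))
        (fun _ _ _ => rfl) fun a b hab => hu ?_
      rw [← show (a : ι → ℚ) = u from Subtype.mk.inj hab]; exact a.2, by
      rintro ⟨x, hx⟩
      rcases Finset.mem_insert.1 hx with rfl | h
      · exact ⟨Sum.inr (), rfl⟩
      · exact ⟨Sum.inl ⟨x, h⟩, rfl⟩⟩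
  have he : (Subtype.val : ↥(insert u N) → ι → ℚ) ∘ e =
      Sum.elim (Subtype.val : N → ι → ℚ) fun _ => u := by
    ext1 (i | i) <;> rfl
  have h1 : minor (Sum.elim (Subtype.val : N → ι → ℚ) fun _ : Unit => u) (f ∘ e) ≠ 0 := by
    rw [← he, minor_comp_equiv]; exact hf
  obtain ⟨σ, hσ⟩ := exists_minor_left_ne_zero h1
  have h2 : (f ∘ e) ∘ σ =
      Sum.elim ((f ∘ e) ∘ σ ∘ Sum.inl) (fun _ => f (e (σ (Sum.inr ())))) := by
    ext (i | i) <;> rfl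
  have h3 : minor (Sum.elim (Subtype.val : N → ι → ℚ) fun _ : Unit => u) ((f ∘ e) ∘ σ) ≠ 0 := by
    rwa [← abs_pos, abs_minor_comp_perm, abs_pos]
  rw [h2, minor_sumElim hσ] at h3
  have h4 := right_ne_zero_of_mul h3
  rw [minor_unit] at h4
  refine ⟨_, _, hσ, fun i => ⟨_, rfl⟩, ⟨_, rfl⟩, h4, fun x => ?_⟩
  refine Eq.trans ?_ (red_sumElim_unit hσ h4 x)
  symm
  have h5 := red_comp_perm h1 σ
  rw [h2] at h5
  rw [h5]
  refine redSet_unique hf ?_ fun i => ?_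
  · have h6 := sub_red_mem_span (Sum.elim (Subtype.val : N → ι → ℚ) fun _ : Unit => u) (f ∘ e) x
    have h7 : Set.range (Subtype.val : ↥(insert u N) → ι → ℚ) = ↑(insert u N) :=
      Subtype.range_coe
    rw [← he, EquivLike.range_comp, h7] at h6
    rwa [← he]
  · have h6 := red_apply_col h1 x (e.symm i)
    simpa using h6

end Finsets
end Equimod

/-! ### Te-sets, tu-sets and even sums -/

namespace Equimod

section Bridge

variable {ι : Type*} [Fintype ι]

theorem _root_.IsIndepSignSet.mono {ι : Type*} {A X : Finset (ι → ℚ)} (hA : IsIndepSignSet A)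
    (h : X ⊆ A) : IsIndepSignSet X :=
  ⟨hA.1.comp (fun x : X => (⟨x, h x.2⟩ : A)) fun _ _ hab => Subtype.ext (Subtype.mk.inj hab),
    fun a ha => hA.2 a (h ha)⟩

theorem isEquimodular_iff {m : Type*} [Fintype m] [DecidableEq m] (M : Matrix m ι ℚ) :
    M.IsEquimodular ↔ ∃ d, IsEqd M.row d := by
  constructor
  · rintro ⟨hli, d, h⟩
    exact ⟨d, exists_minor_ne_zero hli, h⟩
  · rintro ⟨d, h⟩
    exact ⟨h.linearIndependent, d, h.2⟩

theorem hasEqdet_iff (X : Finset (ι → ℚ)) (d : ℚ) :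
    (setMatrix X).HasEqdet d ↔ EqdSet X d := by
  constructor
  · rintro ⟨h, f, hf, hd⟩
    obtain ⟨d', h'⟩ := (isEquimodular_iff _).1 h
    have : d' = d := by rw [← hd]; exact ((h'.2 f).resolve_left hf).symm
    subst this
    exact h'
  · intro h
    obtain ⟨f, hf⟩ := h.exists_isBase
    exact ⟨(isEquimodular_iff _).2 ⟨d, h⟩, f, hf, (h.2 f).resolve_left hf⟩

/-- In a linearly independent set, subsets in place of independent subfamilies of rows. -/
theorem isTESet_iff {A : Finset (ι → ℚ)} :
    IsTESet A ↔ IsIndepSignSet A ∧ ∀ X ⊆ A, ∃ d, EqdSet X d := by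
  refine and_congr_right fun hA => ?_
  have key : ∀ s : Finset A, ∀ d,
      EqdSet (s.map (Function.Embedding.subtype _)) d ↔
        IsEqd ((setMatrix A).submatrix (fun i : s => (i : A)) id).row d := fun s d => by
    refine eqdSet_iff_of_mem_iff ?_ fun x => ?_
    · intro a b hab
      exact Subtype.ext (Subtype.ext hab)
    · constructor
      · intro hx
        obtain ⟨y, hy, rfl⟩ := Finset.mem_map.1 hx
        exact ⟨⟨y, hy⟩, rfl⟩
      · rintro ⟨y, rfl⟩
        exact Finset.mem_map.2 ⟨y, y.2, rfl⟩
  constructor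
  · intro h X hX
    have h1 := h (X.subtype (· ∈ A)) (hA.1.comp (Subtype.val : ↥(X.subtype (· ∈ A)) → A)
      Subtype.val_injective)
    obtain ⟨d, hd⟩ := (isEquimodular_iff _).1 h1
    refine ⟨d, ?_⟩
    rw [← key] at hd
    convert hd
    ext x
    simpa using fun hx => hX hx
  · intro h s _
    obtain ⟨d, hd⟩ := h (s.map (Function.Embedding.subtype _)) (Finset.map_subtype_subset s)
    exact (isEquimodular_iff _).2 ⟨d, (key s d).1 hd⟩

theorem mem_range_signType_cast {x : ℚ} :
    x ∈ Set.range (SignType.cast : SignType → ℚ) ↔ x = 0 ∨ |x| = 1 := by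
  constructor
  · rintro ⟨s, rfl⟩
    cases s <;> simp
  · rintro (rfl | h)
    · exact ⟨0, rfl⟩
    · rcases (abs_eq zero_le_one).1 h with rfl | rfl
      · exact ⟨1, rfl⟩
      · exact ⟨-1, rfl⟩

/-- For linearly independent sign vectors, total unimodularity only has to be tested on the maximal
minors of the subsets of rows. -/
theorem isTUSet_iff {A : Finset (ι → ℚ)} :
    IsTUSet A ↔ IsIndepSignSet A ∧ ∀ X ⊆ A, EqdSet X 1 := by
  refine and_congr_right fun hA => ?_
  constructor
  · intro h X hX
    refine ⟨exists_minor_ne_zero (hA.mono hX).1, fun f => ?_⟩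
    have h1 := (Matrix.isTotallyUnimodular_iff_fintype _).1 h X (fun x => ⟨x, hX x.2⟩) f
    exact mem_range_signType_cast.1 h1
  · intro h k f g hf _
    rw [mem_range_signType_cast]
    have h1 : EqdSet (Finset.univ.image fun i => (f i : ι → ℚ)) 1 :=
      h _ (by intro x hx; obtain ⟨i, -, rfl⟩ := Finset.mem_image.1 hx; exact (f i).2)
    rw [eqdSet_iff_of_mem_iff (v := fun i => (f i : ι → ℚ))
      (fun a b hab => hf (Subtype.ext hab)) (by simp)] at h1
    exact h1.2 g

theorem _root_.IsTUSet.mono {A X : Finset (ι → ℚ)} (h : IsTUSet A) (hX : X ⊆ A) : IsTUSet X := by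
  rw [isTUSet_iff] at h ⊢
  exact ⟨h.1.mono hX, fun Y hY => h.2 Y (hY.trans hX)⟩

theorem _root_.IsTESet.mono {A X : Finset (ι → ℚ)} (h : IsTESet A) (hX : X ⊆ A) : IsTESet X := by
  rw [isTESet_iff] at h ⊢
  exact ⟨h.1.mono hX, fun Y hY => h.2 Y (hY.trans hX)⟩

theorem _root_.IsTUSet.eqdSet {A : Finset (ι → ℚ)} (h : IsTUSet A) : EqdSet A 1 :=
  (isTUSet_iff.1 h).2 A subset_rfl

theorem _root_.IsTESet.exists_eqdSet {A X : Finset (ι → ℚ)} (h : IsTESet A) (hX : X ⊆ A) :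
    ∃ d, EqdSet X d := (isTESet_iff.1 h).2 X hX

/-- A set with at most one vector is totally unimodular. -/
theorem isTUSet_of_card_le_one {A : Finset (ι → ℚ)} (hA : IsIndepSignSet A) (h : A.card ≤ 1) :
    IsTUSet A := by
  refine isTUSet_iff.2 ⟨hA, fun X hX => ?_⟩
  have hX1 := hA.mono hX
  rcases Finset.card_le_one_iff_subset_singleton.1 ((Finset.card_le_card hX).trans h) with ⟨x, hx⟩
  rcases Finset.subset_singleton_iff.1 hx with rfl | rfl
  · exact eqdSet_empty
  · refine ⟨exists_minor_ne_zero hX1.1, fun f => ?_⟩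
    have h1 : minor (Subtype.val : ({x} : Finset (ι → ℚ)) → ι → ℚ) f =
        x (f ⟨x, Finset.mem_singleton_self x⟩) := by
      have := Matrix.det_eq_elem_of_subsingleton
        (Matrix.of fun i j => (Subtype.val : ({x} : Finset (ι → ℚ)) → ι → ℚ) i (f j))
        ⟨x, Finset.mem_singleton_self x⟩
      exact this
    rw [h1]
    rcases hX1.2 x (Finset.mem_singleton_self x) (f ⟨x, Finset.mem_singleton_self x⟩) with
      h | h | h <;> simp [h]

/-- The sum of the vectors of `X` has even entries. -/
def EvenSum (X : Finset (ι → ℚ)) : Prop :=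
  ∀ j, (∑ x ∈ X, x) j ∈ AddSubgroup.zmultiples (2 : ℚ)

/-- The reduction of an even sum is the even sum of the reductions of the vectors outside `N`. -/
theorem EqdSet.redSet_sum_mem {N W : Finset (ι → ℚ)} {f : N → ι} {d : ℚ} (hN : EqdSet N d)
    (hf : IsBase N f) (hW : EvenSum W) (j : ι) :
    (∑ x ∈ W \ N, redSet N f x j) ∈ AddSubgroup.zmultiples (2 : ℚ) := by
  have h := hN.redSet_mem_zmultiples hf hW j
  rw [map_sum, ← Finset.sum_inter_add_sum_sdiff W N] at h
  rw [Finset.sum_eq_zero (s := W ∩ N) fun x hx =>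
    redSet_of_mem hf (Finset.mem_inter.1 hx).2, zero_add, Finset.sum_apply] at h
  exact h

/-- A nonempty set of vectors with even sum is not unimodular. -/
theorem EvenSum.not_isTUSet {W : Finset (ι → ℚ)} (hW : EvenSum W) (hne : W.Nonempty) :
    ¬ IsTUSet W := by
  intro h
  obtain ⟨x, hx⟩ := hne
  have hW1 := h.eqdSet
  rw [← Finset.insert_erase hx] at hW1
  have h1 := (isTUSet_iff.1 h).2 _ (Finset.erase_subset x W)
  have h2 := h1.le_div (Finset.notMem_erase x W) hW1 hW (by
    rw [← Finset.add_sum_erase _ _ hx, sub_add_cancel_left]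
    exact neg_mem (Submodule.sum_mem _ fun y hy => Submodule.subset_span hy))
  norm_num at h2

/-- The entrywise form of the fact that two sign vectors with even sum have the same support; equal
squares express equal supports. -/
theorem sq_eq_of_add_mem {a b : ℚ} (ha : a = 0 ∨ a = 1 ∨ a = -1) (hb : b = 0 ∨ b = 1 ∨ b = -1)
    (h : a + b ∈ AddSubgroup.zmultiples (2 : ℚ)) : a ^ 2 = b ^ 2 := by
  have h1 : ¬ (a + b ≠ 0 ∧ |a + b| < 2) := fun ⟨h0, h2⟩ => by
    have := le_abs_of_mem_zmultiples h h0
    norm_num at this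
    linarith
  rcases ha with rfl | rfl | rfl <;> rcases hb with rfl | rfl | rfl <;> norm_num at h1 <;> norm_num

theorem sign_of_abs {a : ℚ} (h : a = 0 ∨ |a| = 1) : a = 0 ∨ a = 1 ∨ a = -1 :=
  h.imp_right fun h => (abs_eq zero_le_one).1 h

end Bridge
end Equimod

/-! ### Te-laces -/

open scoped symmDiff

namespace Equimod

section Laces

variable {ι : Type*} [Fintype ι]

theorem sign_mem_zmultiples_one {a : ℚ} (ha : a = 0 ∨ a = 1 ∨ a = -1) :
    a ∈ AddSubgroup.zmultiples (1 : ℚ) := by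
  rcases ha with rfl | rfl | rfl
  · exact zero_mem _
  · exact AddSubgroup.mem_zmultiples _
  · exact neg_mem (AddSubgroup.mem_zmultiples _)

theorem mul_mem_zmultiples {k a b : ℚ} (ha : a ∈ AddSubgroup.zmultiples k)
    (hb : b ∈ AddSubgroup.zmultiples (1 : ℚ)) : a * b ∈ AddSubgroup.zmultiples k := by
  obtain ⟨z, rfl⟩ := AddSubgroup.mem_zmultiples_iff.1 hb
  have : a * z • (1 : ℚ) = z • a := by simp [mul_comm]
  rw [this]
  exact zsmul_mem ha z

theorem isTUSet_of_ssubset {X : Finset (ι → ℚ)} (hX : IsIndepSignSet X) (h1 : EqdSet X 1)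
    (h : ∀ Y, Y ⊂ X → IsTUSet Y) : IsTUSet X := by
  refine isTUSet_iff.2 ⟨hX, fun Y hY => ?_⟩
  rcases hY.eq_or_ssubset with rfl | hY
  · exact h1
  · exact (h Y hY).eqdSet

theorem _root_.IsTELace.two_le_card {X : Finset (ι → ℚ)} (h : IsTELace X) : 2 ≤ X.card := by
  by_contra hlt
  exact h.2.1 (isTUSet_of_card_le_one h.1.1 (by omega))

/-- A te-lace has equideterminant `2`: it is not `1`, and `EqdSet.mul_eq_or` applies to two vectors
of the lace and the unimodular rest. -/
theorem _root_.IsTELace.eqdSet {X : Finset (ι → ℚ)} (h : IsTELace X) : EqdSet X 2 := by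
  obtain ⟨a, ha, b, hb, hab⟩ := Finset.one_lt_card.1 h.two_le_card
  obtain ⟨d, hd⟩ := h.1.exists_eqdSet subset_rfl
  have e : X = insert a (insert b ((X.erase a).erase b)) := by
    rw [Finset.insert_erase (Finset.mem_erase.2 ⟨hab.symm, hb⟩), Finset.insert_erase ha]
  have ha' : a ∉ (X.erase a).erase b := by simp
  have hb' : b ∉ (X.erase a).erase b := by simp
  have hTU : ∀ x ∈ X, ∀ Y ⊆ X, x ∉ Y → EqdSet Y 1 := fun x hx Y hY hxY =>
    (h.2.2 Y (hY.ssubset_of_ne fun h => hxY (h ▸ hx))).eqdSet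
  have hs : (X.erase a).erase b ⊆ X :=
    (Finset.erase_subset _ _).trans (Finset.erase_subset _ _)
  have h0 := hTU a ha _ hs ha'
  have h1 := hTU b hb (insert a ((X.erase a).erase b)) (Finset.insert_subset ha hs)
    (by simp [hab.symm])
  have h2 := hTU a ha (insert b ((X.erase a).erase b)) (Finset.insert_subset hb hs)
    (by simp [hab])
  have h3 := hd
  rw [e] at h3
  rcases h0.mul_eq_or ha' hb' hab h1 h2 h3 with h4 | h4
  · exact absurd (isTUSet_of_ssubset h.1.1 (by convert hd using 1; linarith) h.2.2) h.2.1
  · convert hd using 1; linarith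

/-- The vectors of a te-lace are dependent modulo `2` and, by minimality, all of them occur in this
dependency. -/
theorem _root_.IsTELace.evenSum {X : Finset (ι → ℚ)} (h : IsTELace X) : EvenSum X := by
  classical
  obtain ⟨x, hx⟩ : X.Nonempty := Finset.card_pos.1 (by have := h.two_le_card; omega)
  have hTU : ∀ x ∈ X, EqdSet (X.erase x) 1 := fun x hx =>
    (h.2.2 _ (Finset.erase_ssubset hx)).eqdSet
  obtain ⟨f, hf⟩ := (hTU x hx).exists_isBase
  have hxN := Finset.notMem_erase x X
  obtain ⟨h1, -⟩ := (hTU x hx).redSet_entry hxN (by rw [Finset.insert_erase hx]; exact h.eqdSet) hf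
  obtain ⟨c, hc, hc2⟩ := (hTU x hx).exists_row_coeff hf hxN
  have hc3 : ∀ r ∈ X.erase x, c r = 0 ∨ c r = 1 ∨ c r = -1 := by
    intro r hr
    obtain ⟨hrx, hrX⟩ := Finset.mem_erase.1 hr
    have h3 : insert x ((X.erase x).erase r) = X.erase r := by
      rw [Finset.erase_right_comm, Finset.insert_erase (Finset.mem_erase.2 ⟨hrx.symm, hx⟩)]
    have h2 := hc2 r hr 1 (by rw [h3]; exact hTU r hrX)
    rw [div_one] at h2
    exact sign_of_abs h2
  set W := insert x ((X.erase x).filter fun r => c r ≠ 0) with hWdef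
  have hWX : W ⊆ X := Finset.insert_subset hx
    ((Finset.filter_subset _ _).trans (Finset.erase_subset _ _))
  have hW : EvenSum W := by
    intro j
    have e1 : (∑ y ∈ W, y) j = redSet (X.erase x) f x j +
        ∑ r ∈ X.erase x, (c r + if c r ≠ 0 then 1 else 0) * r j := by
      rw [hWdef, Finset.sum_insert (by simp), hc, Finset.sum_filter]
      simp only [Pi.add_apply, Finset.sum_apply, Pi.sub_apply, Pi.smul_apply, smul_eq_mul, add_mul,
        Finset.sum_add_distrib]
      have : ∀ r : ι → ℚ, (if c r ≠ 0 then r else 0) j = (if c r ≠ 0 then 1 else 0) * r j := by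
        intro r; split_ifs <;> simp
      simp only [this]
      ring
    rw [e1]
    refine add_mem ?_ (sum_mem fun r hr => mul_mem_zmultiples ?_
      (sign_mem_zmultiples_one (h.1.1.2 r (Finset.mem_of_mem_erase hr) j)))
    · rcases h1 j with h4 | h4
      · rw [h4]; exact zero_mem _
      · rcases (abs_eq (by norm_num)).1 h4 with h4 | h4 <;> rw [h4]
        · simp
        · simp
    · rcases hc3 r hr with h4 | h4 | h4 <;> rw [h4] <;> norm_num
  -- If `W` were a proper subset, it would be unimodular in spite of its even sum.
  by_contra hX
  have hne : W ≠ X := fun h => hX (h ▸ hW)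
  exact hW.not_isTUSet ⟨x, Finset.mem_insert_self _ _⟩ (h.2.2 W (hWX.ssubset_of_ne hne))

theorem exists_lace_subset {A X : Finset (ι → ℚ)} (hA : IsTESet A) (hX : X ⊆ A)
    (h : ¬ IsTUSet X) : ∃ C ⊆ X, IsTELace C := by
  induction X using Finset.strongInduction with
  | H X ih =>
    by_cases h1 : ∀ Y, Y ⊂ X → IsTUSet Y
    · exact ⟨X, subset_rfl, hA.mono hX, h, h1⟩
    · push Not at h1
      obtain ⟨Y, hY, hY1⟩ := h1
      obtain ⟨C, hC, hC1⟩ := ih Y hY (hY.subset.trans hX) hY1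
      exact ⟨C, hC.trans hY.subset, hC1⟩

theorem _root_.IsTELace.eq_of_subset {X Y : Finset (ι → ℚ)} (hX : IsTELace X) (hY : ¬ IsTUSet Y)
    (h : Y ⊆ X) : Y = X := by
  by_contra hne
  exact hY (hX.2.2 Y (h.ssubset_of_ne hne))

theorem _root_.IsTELace.pair_ne {a b : ι → ℚ} (h : IsTELace {a, b}) : a ≠ b := by
  rintro rfl
  simpa using h.two_le_card

theorem _root_.IsTELace.sq_eq {a b : ι → ℚ} (h : IsTELace {a, b}) (j : ι) :
    a j ^ 2 = b j ^ 2 := by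
  have h1 := h.evenSum j
  rw [Finset.sum_pair h.pair_ne] at h1
  exact sq_eq_of_add_mem (h.1.1.2 a (by simp) j) (h.1.1.2 b (by simp) j) h1

theorem add_mem_of_sq_eq {a b : ℚ} (ha : a = 0 ∨ a = 1 ∨ a = -1) (hb : b = 0 ∨ b = 1 ∨ b = -1)
    (h : a ^ 2 = b ^ 2) : a + b ∈ AddSubgroup.zmultiples (2 : ℚ) := by
  have h2 := AddSubgroup.mem_zmultiples (2 : ℚ)
  rcases ha with rfl | rfl | rfl <;> rcases hb with rfl | rfl | rfl <;> norm_num at h <;> norm_num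

/-- Two vectors of a te-set form a te-lace as soon as they have the same support. -/
theorem isTELace_pair {A : Finset (ι → ℚ)} (hA : IsTESet A) {a b : ι → ℚ} (ha : a ∈ A) (hb : b ∈ A)
    (hab : a ≠ b) (h : ∀ j, a j ^ 2 = b j ^ 2) : IsTELace {a, b} := by
  have hs : {a, b} ⊆ A := by
    intro x hx
    rcases Finset.mem_insert.1 hx with rfl | hx
    · exact ha
    · rwa [Finset.mem_singleton.1 hx]
  refine ⟨hA.mono hs, EvenSum.not_isTUSet (fun j => ?_) ⟨a, by simp⟩, fun Y hY => ?_⟩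
  · rw [Finset.sum_pair hab]
    exact add_mem_of_sq_eq (hA.1.2 a ha j) (hA.1.2 b hb j) (h j)
  · refine isTUSet_of_card_le_one (hA.1.mono (hY.subset.trans hs)) ?_
    have := Finset.card_lt_card hY
    rw [Finset.card_pair hab] at this
    omega

theorem linearIndependent_of_injective {ι : Type*} {A : Finset (ι → ℚ)} (hA : IsIndepSignSet A)
    {m : Type*} {v : m → ι → ℚ} (hv : Function.Injective v) (h : ∀ i, v i ∈ A) :
    LinearIndependent ℚ v :=
  hA.1.comp (fun i => (⟨v i, h i⟩ : A)) fun _ _ hab => hv (Subtype.mk.inj hab)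

theorem notMem_span {ι : Type*} {A X : Finset (ι → ℚ)} (hA : IsIndepSignSet A)
    (hX : X ⊆ A) {a : ι → ℚ} (ha : a ∈ A) (haX : a ∉ X) :
    a ∉ Submodule.span ℚ (X : Set (ι → ℚ)) := by
  have h := hA.1.notMem_span_image (s := {x | (x : ι → ℚ) ∈ X}) (x := ⟨a, ha⟩) haX
  convert h using 3
  ext y
  simpa using fun hy => hX hy

/-- If the dependency modulo `2` of `a`, `b` with vectors of `P` is the only one, then the
equideterminant doubles when both vectors are added. -/
theorem eqdSet_insert_insert_of_evenSum {A P W : Finset (ι → ℚ)} (hA : IsIndepSignSet A)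
    {a b : ι → ℚ} (hs : insert a (insert b P) ⊆ A) (ha : a ∉ P) (hb : b ∉ P) (hab : a ≠ b)
    (hW : W \ P = {a, b}) (hWe : EvenSum W) {D : ℚ} (h0 : EqdSet P D)
    (h1 : EqdSet (insert a P) D) (h2 : EqdSet (insert b P) D) :
    EqdSet (insert a (insert b P)) (D * 2) := by
  rw [eqdSet_insert_insert ha hb hab]
  have haA : a ∈ A := hs (by simp)
  have hbA : b ∈ A := hs (by simp)
  refine IsEqd.of_red h0 (linearIndependent_of_injective hA ?_ ?_) fun f hf g => ?_
  · refine Subtype.val_injective.sumElim ?_ fun x i hxi => ?_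
    · intro i j
      fin_cases i <;> fin_cases j <;> simp [hab, hab.symm]
    · fin_cases i
      · exact ha (by rw [← show (x : ι → ℚ) = a from hxi]; exact x.2)
      · exact hb (by rw [← show (x : ι → ℚ) = b from hxi]; exact x.2)
  · rintro (x | i)
    · exact hs (by simp)
    · fin_cases i
      · exact haA
      · exact hbA
  · have e1 := (h0.redSet_entry ha h1 hf).1
    have e2 := (h0.redSet_entry hb h2 hf).1
    rw [div_self h0.pos.ne'] at e1 e2
    have e3 : ∀ j, redSet P f a j ^ 2 = redSet P f b j ^ 2 := fun j => by
      have := h0.redSet_sum_mem hf hWe j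
      rw [hW, Finset.sum_pair hab] at this
      exact sq_eq_of_add_mem (sign_of_abs (e1 j)) (sign_of_abs (e2 j)) this
    have key : ∀ x y z w : ℚ, (x = 0 ∨ x = 1 ∨ x = -1) → (y = 0 ∨ y = 1 ∨ y = -1) →
        (z = 0 ∨ z = 1 ∨ z = -1) → (w = 0 ∨ w = 1 ∨ w = -1) → x ^ 2 = z ^ 2 → y ^ 2 = w ^ 2 →
        x * w - y * z = 0 ∨ |x * w - y * z| = 2 := by
      intro x y z w hx hy hz hw
      rcases hx with rfl | rfl | rfl <;> rcases hy with rfl | rfl | rfl <;>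
      rcases hz with rfl | rfl | rfl <;> rcases hw with rfl | rfl | rfl <;> norm_num
    rw [minor_fin_two]
    exact key _ _ _ _ (sign_of_abs (e1 _)) (sign_of_abs (e1 _)) (sign_of_abs (e2 _))
      (sign_of_abs (e2 _)) (e3 _) (e3 _)

/-- Two sign vectors with all `2 × 2` minors at most `1` in absolute value agree up to a common sign
on the columns where both are nonzero. -/
theorem exists_sign_mul {ι : Type*} {x y : ι → ℚ} (S : ι → Prop)
    (hx : ∀ j, S j → x j = 1 ∨ x j = -1)
    (hy : ∀ j, S j → y j = 1 ∨ y j = -1) (h : ∀ j k, |x j * y k - x k * y j| ≤ 1) :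
    ∃ β : ℚ, (β = 1 ∨ β = -1) ∧ ∀ j, S j → y j = β * x j := by
  by_cases hS : ∃ j, S j
  · obtain ⟨j, hj⟩ := hS
    refine ⟨x j * y j, ?_, fun k hk => ?_⟩
    · rcases hx j hj with h1 | h1 <;> rcases hy j hj with h2 | h2 <;> rw [h1, h2] <;> norm_num
    · have h3 := h j k
      rcases hx j hj with h1 | h1 <;> rcases hy j hj with h2 | h2 <;>
      rcases hx k hk with h4 | h4 <;> rcases hy k hk with h5 | h5 <;>
      rw [h1, h2, h4, h5] at h3 <;> rw [h1, h2, h4, h5] <;> norm_num at h3 <;> norm_num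
  · exact ⟨1, Or.inl rfl, fun j hj => absurd ⟨j, hj⟩ hS⟩

/-- The local obstruction behind the disjointness of te-laces: four sign vectors `a, b, c, u` with
`a + c` and `a + b + u` even, all pairs but `a, c` being unimodular, are linearly dependent. -/
theorem dependent_of_theta {ι : Type*} {a b c u : ι → ℚ}
    (sa : ∀ j, a j = 0 ∨ a j = 1 ∨ a j = -1)
    (sb : ∀ j, b j = 0 ∨ b j = 1 ∨ b j = -1) (sc : ∀ j, c j = 0 ∨ c j = 1 ∨ c j = -1)
    (su : ∀ j, u j = 0 ∨ u j = 1 ∨ u j = -1)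
    (hab : ∀ j k, |a j * b k - a k * b j| ≤ 1) (hcb : ∀ j k, |c j * b k - c k * b j| ≤ 1)
    (hau : ∀ j k, |a j * u k - a k * u j| ≤ 1) (hcu : ∀ j k, |c j * u k - c k * u j| ≤ 1)
    (hbu : ∀ j k, |b j * u k - b k * u j| ≤ 1)
    (hac : ∀ j, a j + c j ∈ AddSubgroup.zmultiples (2 : ℚ))
    (habu : ∀ j, a j + b j + u j ∈ AddSubgroup.zmultiples (2 : ℚ)) :
    (∃ p q : ℚ, a = p • b + q • u) ∨ (∃ p q : ℚ, c = p • b + q • u) ∨ ∃ p : ℚ, c = p • a := by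
  have hac' := fun j => sq_eq_of_add_mem (sa j) (sc j) (hac j)
  have habu' : ∀ j, (a j = 0 ∧ b j = 0 ∧ u j = 0) ∨ (a j = 0 ∧ b j ≠ 0 ∧ u j ≠ 0) ∨
      (a j ≠ 0 ∧ b j ≠ 0 ∧ u j = 0) ∨ (a j ≠ 0 ∧ b j = 0 ∧ u j ≠ 0) := by
    intro j
    have h1 : ¬ (a j + b j + u j ≠ 0 ∧ |a j + b j + u j| < 2) := fun ⟨h0, h2⟩ => by
      have := le_abs_of_mem_zmultiples (habu j) h0
      norm_num at this
      linarith
    have h2 : |a j + b j + u j| ≠ 3 := fun h3 => by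
      obtain ⟨z, hz⟩ := AddSubgroup.mem_zmultiples_iff.1 (habu j)
      rw [← hz, zsmul_eq_mul] at h3
      rcases (abs_eq (by norm_num)).1 h3 with h3 | h3
      · have : z * 2 = 3 := by exact_mod_cast h3
        omega
      · have : z * 2 = -3 := by exact_mod_cast h3
        omega
    rcases sa j with h | h | h <;> rcases sb j with h' | h' | h' <;>
    rcases su j with h'' | h'' | h'' <;> rw [h, h', h''] at h1 h2 ⊢ <;>
    first | (norm_num; done) | (norm_num at h1; done) | (norm_num at h2)
  have nz : ∀ {x : ℚ}, (x = 0 ∨ x = 1 ∨ x = -1) → x ≠ 0 → x = 1 ∨ x = -1 := fun h h0 =>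
    h.resolve_left h0
  have ca : ∀ {j}, a j ≠ 0 → c j ≠ 0 := fun {j} h h0 => h (by
    have := hac' j; rw [h0] at this; simpa using this)
  have ac : ∀ {j}, a j = 0 → c j = 0 := fun {j} h => by
    have := hac' j; rw [h] at this; simpa using this.symm
  -- The columns are of the types `a, b ≠ 0`, `a, u ≠ 0` and `b, u ≠ 0`; on each of them the vectors
  -- involved agree up to a sign, and these five signs determine the dependency.
  obtain ⟨β, hβ, h1⟩ := exists_sign_mul (fun j => a j ≠ 0 ∧ b j ≠ 0) (fun j h => nz (sb j) h.2)
    (fun j h => nz (sa j) h.1) (x := b) (y := a) (fun j k => by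
      rw [← abs_neg]; convert hab j k using 2; ring)
  obtain ⟨γ, hγ, h2⟩ := exists_sign_mul (fun j => a j ≠ 0 ∧ b j ≠ 0) (fun j h => nz (sb j) h.2)
    (fun j h => nz (sc j) (ca h.1)) (x := b) (y := c) (fun j k => by
      rw [← abs_neg]; convert hcb j k using 2; ring)
  obtain ⟨β', hβ', h3⟩ := exists_sign_mul (fun j => a j ≠ 0 ∧ u j ≠ 0) (fun j h => nz (su j) h.2)
    (fun j h => nz (sa j) h.1) (x := u) (y := a) (fun j k => by
      rw [← abs_neg]; convert hau j k using 2; ring)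
  obtain ⟨γ', hγ', h4⟩ := exists_sign_mul (fun j => a j ≠ 0 ∧ u j ≠ 0) (fun j h => nz (su j) h.2)
    (fun j h => nz (sc j) (ca h.1)) (x := u) (y := c) (fun j k => by
      rw [← abs_neg]; convert hcu j k using 2; ring)
  obtain ⟨ε, hε, h5⟩ := exists_sign_mul (fun j => a j = 0 ∧ b j ≠ 0) (fun j h => nz (sb j) h.2)
    (fun j h => nz (su j) (by
      rcases habu' j with h' | h' | h' | h' <;> simp_all)) (x := b) (y := u) hbu
  by_cases e1 : β + β' * ε = 0
  · left
    refine ⟨β, β', funext fun j => ?_⟩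
    simp only [Pi.add_apply, Pi.smul_apply, smul_eq_mul]
    rcases habu' j with ⟨h, h', h''⟩ | ⟨h, h', h''⟩ | ⟨h, h', h''⟩ | ⟨h, h', h''⟩
    · simp [h, h', h'']
    · rw [h5 j ⟨h, h'⟩, h]; linear_combination -b j * e1
    · rw [h1 j ⟨h, h'⟩, h'']; ring
    · rw [h3 j ⟨h, h''⟩, h']; ring
  by_cases e2 : γ + γ' * ε = 0
  · right; left
    refine ⟨γ, γ', funext fun j => ?_⟩
    simp only [Pi.add_apply, Pi.smul_apply, smul_eq_mul]
    rcases habu' j with ⟨h, h', h''⟩ | ⟨h, h', h''⟩ | ⟨h, h', h''⟩ | ⟨h, h', h''⟩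
    · simp [ac h, h', h'']
    · rw [h5 j ⟨h, h'⟩, ac h]; linear_combination -b j * e2
    · rw [h2 j ⟨h, h'⟩, h'']; ring
    · rw [h4 j ⟨h, h''⟩, h']; ring
  · right; right
    have e3 : β * γ = β' * γ' := by
      rcases hβ with rfl | rfl <;> rcases hβ' with rfl | rfl <;> rcases hγ with rfl | rfl <;>
      rcases hγ' with rfl | rfl <;> rcases hε with rfl | rfl <;>
    first | (norm_num; done) | (norm_num at e1; done) | (norm_num at e2)
    have b2 : β * β = 1 := by rcases hβ with rfl | rfl <;> norm_num
    have b2' : β' * β' = 1 := by rcases hβ' with rfl | rfl <;> norm_num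
    refine ⟨β * γ, funext fun j => ?_⟩
    simp only [Pi.smul_apply, smul_eq_mul]
    rcases habu' j with ⟨h, h', h''⟩ | ⟨h, h', h''⟩ | ⟨h, h', h''⟩ | ⟨h, h', h''⟩
    · simp [ac h, h]
    · simp [ac h, h]
    · rw [h2 j ⟨h, h'⟩, h1 j ⟨h, h'⟩]; linear_combination (-γ * b j) * b2
    · rw [h4 j ⟨h, h''⟩, e3, h3 j ⟨h, h''⟩]; linear_combination (-γ' * u j) * b2'

theorem EvenSum.symmDiff {X Y : Finset (ι → ℚ)}
    (hs : ∀ x ∈ X, ∀ j, x j = 0 ∨ x j = 1 ∨ x j = -1) (hX : EvenSum X)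
    (hY : EvenSum Y) : EvenSum (X ∆ Y) := by
  intro j
  have h1 : (∑ x ∈ X ∆ Y, x) j =
      (∑ x ∈ X, x) j + (∑ x ∈ Y, x) j - ∑ x ∈ X ∩ Y, 2 * x j := by
    have e : X ∆ Y = X \ Y ∪ Y \ X := rfl
    rw [e, Finset.sum_union disjoint_sdiff_sdiff, ← Finset.sum_inter_add_sum_sdiff X Y,
      ← Finset.sum_inter_add_sum_sdiff Y X, Finset.inter_comm Y X, ← Finset.mul_sum]
    simp only [Pi.add_apply, Finset.sum_apply]
    ring
  rw [h1]
  exact sub_mem (add_mem (hX j) (hY j)) (sum_mem fun x hx => mul_mem_zmultiples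
    (AddSubgroup.mem_zmultiples _) (sign_mem_zmultiples_one
      (hs x (Finset.mem_inter.1 hx).1 j)))

theorem abs_minor_le_one {N : Finset (ι → ℚ)} {f : N → ι} {x y : ι → ℚ} (hN : EqdSet N 1)
    (hx : x ∉ N) (hy : y ∉ N) (hxy : x ≠ y) (h : EqdSet (insert x (insert y N)) 1)
    (hf : IsBase N f) (j k : ι) :
    |redSet N f x j * redSet N f y k - redSet N f x k * redSet N f y j| ≤ 1 := by
  rcases (hN.redSet_pair hx hy hxy h hf).1 j k with h | h <;> simp [h]

theorem sdiff_eq_triple {α : Type*} [DecidableEq α] {C₁ C₂ : Finset α} {u b a c : α} (hu : u ∈ C₁)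
    (hb : b ∈ C₁) (ha : a ∈ C₁) (hc : c ∉ C₁) :
    C₁ \ ((C₁ ∪ C₂) \ {u, b, a, c}) = {a, b, u} := by
  ext x
  have : x ∈ C₁ → x ≠ c := fun h h' => hc (h' ▸ h)
  simp only [Finset.mem_sdiff, Finset.mem_union, Finset.mem_insert, Finset.mem_singleton]
  constructor
  · tauto
  · rintro (rfl | rfl | rfl) <;> tauto

theorem sdiff_eq_pair {α : Type*} [DecidableEq α] {C₁ C₂ : Finset α} {u b a c : α} (hu : u ∉ C₂)
    (hb : b ∉ C₂) (ha : a ∈ C₂) (hc : c ∈ C₂) :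
    C₂ \ ((C₁ ∪ C₂) \ {u, b, a, c}) = {a, c} := by
  ext x
  have : x ∈ C₂ → x ≠ u := fun h h' => hu (h' ▸ h)
  have : x ∈ C₂ → x ≠ b := fun h h' => hb (h' ▸ h)
  simp only [Finset.mem_sdiff, Finset.mem_union, Finset.mem_insert, Finset.mem_singleton]
  constructor
  · tauto
  · rintro (rfl | rfl) <;> tauto

/-- A te-set contains no theta, that is, two sets with even sums which intersect, of which neither
contains the other and one has at least two vectors outside the other, and whose union contains no
te-laces except possibly the two sets and their symmetric difference. Modulo the remaining vectors
this is the obstruction `dependent_of_theta`. -/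
theorem theta_false {A C₁ C₂ : Finset (ι → ℚ)} (hA : IsTESet A) (hs : C₁ ∪ C₂ ⊆ A)
    (h₁ : EvenSum C₁) (h₂ : EvenSum C₂)
    (hl : ∀ C ⊆ C₁ ∪ C₂, IsTELace C → C = C₁ ∨ C = C₂ ∨ C = C₁ ∆ C₂)
    {u b a c : ι → ℚ} (hub : u ≠ b) (hu : u ∈ C₁ \ C₂) (hb : b ∈ C₁ \ C₂) (ha : a ∈ C₁ ∩ C₂)
    (hc : c ∈ C₂ \ C₁) : False := by
  rw [Finset.mem_sdiff] at hu hb hc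
  rw [Finset.mem_inter] at ha
  obtain ⟨hu1, hu2⟩ := hu
  obtain ⟨hb1, hb2⟩ := hb
  obtain ⟨ha1, ha2⟩ := ha
  obtain ⟨hc2, hc1⟩ := hc
  have hau : a ≠ u := fun h => hu2 (h ▸ ha2)
  have hab : a ≠ b := fun h => hb2 (h ▸ ha2)
  have hcu : c ≠ u := fun h => hc1 (h ▸ hu1)
  have hcb : c ≠ b := fun h => hc1 (h ▸ hb1)
  have hac : a ≠ c := fun h => hc1 (h ▸ ha1)
  set N := (C₁ ∪ C₂) \ {u, b, a, c} with hN
  have hNs : N ⊆ C₁ ∪ C₂ := Finset.sdiff_subset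
  have hTU : ∀ Y ⊆ C₁ ∪ C₂, (∃ x ∈ C₁, x ∉ Y) → (∃ x ∈ C₂, x ∉ Y) → (∃ x ∈ C₁ ∆ C₂, x ∉ Y) →
      EqdSet Y 1 := by
    intro Y hY ⟨x, hx, hxY⟩ ⟨y, hy, hyY⟩ ⟨z, hz, hzY⟩
    by_cases h : IsTUSet Y
    · exact h.eqdSet
    · obtain ⟨C, hC, hCl⟩ := exists_lace_subset hA (hY.trans hs) h
      rcases hl C (hC.trans hY) hCl with rfl | rfl | rfl
      · exact absurd (hC hx) hxY
      · exact absurd (hC hy) hyY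
      · exact absurd (hC hz) hzY
  have su : u ∈ C₁ ∆ C₂ := Finset.mem_symmDiff.2 (Or.inl ⟨hu1, hu2⟩)
  have sb : b ∈ C₁ ∆ C₂ := Finset.mem_symmDiff.2 (Or.inl ⟨hb1, hb2⟩)
  have sc : c ∈ C₁ ∆ C₂ := Finset.mem_symmDiff.2 (Or.inr ⟨hc2, hc1⟩)
  have uN : u ∉ N := by simp [hN]
  have bN : b ∉ N := by simp [hN]
  have aN : a ∉ N := by simp [hN]
  have cN : c ∉ N := by simp [hN]
  have mu : u ∈ C₁ ∪ C₂ := Finset.mem_union_left _ hu1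
  have mb : b ∈ C₁ ∪ C₂ := Finset.mem_union_left _ hb1
  have ma : a ∈ C₁ ∪ C₂ := Finset.mem_union_left _ ha1
  have mc : c ∈ C₁ ∪ C₂ := Finset.mem_union_right _ hc2
  have tN : EqdSet N 1 := hTU N hNs ⟨u, hu1, uN⟩ ⟨a, ha2, aN⟩ ⟨u, su, uN⟩
  have ta : EqdSet (insert a N) 1 := hTU _ (Finset.insert_subset ma hNs)
    ⟨u, hu1, by simp [uN, hau.symm]⟩ ⟨c, hc2, by simp [cN, hac.symm]⟩
    ⟨u, su, by simp [uN, hau.symm]⟩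
  have tb : EqdSet (insert b N) 1 := hTU _ (Finset.insert_subset mb hNs)
    ⟨u, hu1, by simp [uN, hub]⟩ ⟨c, hc2, by simp [cN, hcb]⟩ ⟨u, su, by simp [uN, hub]⟩
  have tu : EqdSet (insert u N) 1 := hTU _ (Finset.insert_subset mu hNs)
    ⟨b, hb1, by simp [bN, hub.symm]⟩ ⟨c, hc2, by simp [cN, hcu]⟩ ⟨b, sb, by simp [bN, hub.symm]⟩
  have tc : EqdSet (insert c N) 1 := hTU _ (Finset.insert_subset mc hNs)
    ⟨u, hu1, by simp [uN, hcu.symm]⟩ ⟨a, ha2, by simp [aN, hac]⟩ ⟨u, su, by simp [uN, hcu.symm]⟩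
  have tab : EqdSet (insert a (insert b N)) 1 := hTU _
    (Finset.insert_subset ma (Finset.insert_subset mb hNs))
    ⟨u, hu1, by simp [uN, hau.symm, hub]⟩ ⟨c, hc2, by simp [cN, hac.symm, hcb]⟩
    ⟨u, su, by simp [uN, hau.symm, hub]⟩
  have tcb : EqdSet (insert c (insert b N)) 1 := hTU _
    (Finset.insert_subset mc (Finset.insert_subset mb hNs))
    ⟨u, hu1, by simp [uN, hcu.symm, hub]⟩ ⟨a, ha2, by simp [aN, hac, hab]⟩
    ⟨u, su, by simp [uN, hcu.symm, hub]⟩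
  have tau : EqdSet (insert a (insert u N)) 1 := hTU _
    (Finset.insert_subset ma (Finset.insert_subset mu hNs))
    ⟨b, hb1, by simp [bN, hab.symm, hub.symm]⟩ ⟨c, hc2, by simp [cN, hac.symm, hcu]⟩
    ⟨b, sb, by simp [bN, hab.symm, hub.symm]⟩
  have tcu : EqdSet (insert c (insert u N)) 1 := hTU _
    (Finset.insert_subset mc (Finset.insert_subset mu hNs))
    ⟨b, hb1, by simp [bN, hcb.symm, hub.symm]⟩ ⟨a, ha2, by simp [aN, hac, hau]⟩
    ⟨b, sb, by simp [bN, hcb.symm, hub.symm]⟩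
  have tbu : EqdSet (insert b (insert u N)) 1 := hTU _
    (Finset.insert_subset mb (Finset.insert_subset mu hNs))
    ⟨a, ha1, by simp [aN, hab, hau]⟩ ⟨a, ha2, by simp [aN, hab, hau]⟩
    ⟨c, sc, by simp [cN, hcb, hcu]⟩
  obtain ⟨f, hf⟩ := tN.exists_isBase
  have sgn : ∀ {x}, x ∉ N → EqdSet (insert x N) 1 → ∀ j, redSet N f x j = 0 ∨
      redSet N f x j = 1 ∨ redSet N f x j = -1 := fun hx h j =>
    sign_of_abs (by simpa using (tN.redSet_entry hx h hf).1 j)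
  have e₁ : C₁ \ N = {a, b, u} := sdiff_eq_triple hu1 hb1 ha1 hc1
  have e₂ : C₂ \ N = {a, c} := sdiff_eq_pair hu2 hb2 ha2 hc2
  have key := dependent_of_theta (sgn aN ta) (sgn bN tb) (sgn cN tc) (sgn uN tu)
    (abs_minor_le_one tN aN bN hab tab hf) (abs_minor_le_one tN cN bN hcb tcb hf)
    (abs_minor_le_one tN aN uN hau tau hf) (abs_minor_le_one tN cN uN hcu tcu hf)
    (abs_minor_le_one tN bN uN hub.symm tbu hf)
    (fun j => by
      have := tN.redSet_sum_mem hf h₂ j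
      rwa [e₂, Finset.sum_pair hac] at this)
    (fun j => by
      have := tN.redSet_sum_mem hf h₁ j
      rwa [e₁, Finset.sum_insert (by simp [hab, hau]), Finset.sum_pair hub.symm,
        ← add_assoc] at this)
  have li : ∀ (x : ι → ℚ) (X : Finset (ι → ℚ)) (y : ι → ℚ), N ⊆ X → X ⊆ C₁ ∪ C₂ →
      x ∈ C₁ ∪ C₂ → x ∉ X → y ∈ Submodule.span ℚ (X : Set (ι → ℚ)) →
      redSet N f x ≠ redSet N f y := by
    intro x X y hNX hX hx hxX hy h
    have h1 := sub_redSet_mem_span f (x - y)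
    rw [map_sub, h, sub_self, sub_zero] at h1
    have h2 := Submodule.span_mono (R := ℚ) (Finset.coe_subset.2 hNX) h1
    exact notMem_span hA.1 (hX.trans hs) (hs hx) hxX (by simpa using add_mem h2 hy)
  rcases key with ⟨p, q, h⟩ | ⟨p, q, h⟩ | ⟨p, h⟩
  · refine li a (insert b (insert u N)) (p • b + q • u) ?_ ?_ ma (by simp [aN, hab, hau]) ?_ ?_
    · exact (Finset.subset_insert _ _).trans (Finset.subset_insert _ _)
    · exact Finset.insert_subset mb (Finset.insert_subset mu hNs)
    · exact add_mem (Submodule.smul_mem _ _ (Submodule.subset_span (by simp)))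
        (Submodule.smul_mem _ _ (Submodule.subset_span (by simp)))
    · simpa using h
  · refine li c (insert b (insert u N)) (p • b + q • u) ?_ ?_ mc (by simp [cN, hcb, hcu]) ?_ ?_
    · exact (Finset.subset_insert _ _).trans (Finset.subset_insert _ _)
    · exact Finset.insert_subset mb (Finset.insert_subset mu hNs)
    · exact add_mem (Submodule.smul_mem _ _ (Submodule.subset_span (by simp)))
        (Submodule.smul_mem _ _ (Submodule.subset_span (by simp)))
    · simpa using h
  · refine li c (insert a N) (p • a) (Finset.subset_insert _ _) (Finset.insert_subset ma hNs) mc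
      (by simp [cN, hac.symm]) (Submodule.smul_mem _ _ (Submodule.subset_span (by simp))) ?_
    simpa using h

/-- In a te-set, a te-lace with at least three vectors is disjoint from all other te-laces. -/
theorem _root_.IsTELace.disjoint {A C₁ C₂ : Finset (ι → ℚ)} (hA : IsTESet A) (h₁ : IsTELace C₁)
    (h₂ : IsTELace C₂) (hs₁ : C₁ ⊆ A) (hs₂ : C₂ ⊆ A) (hne : C₂ ≠ C₁) (hc : 3 ≤ C₁.card) :
    Disjoint C₁ C₂ := by
  classical
  by_contra hd
  -- Among the te-laces that meet `C₁`, take one with the smallest union with `C₁`.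
  let 𝓕 := A.powerset.filter fun C => IsTELace C ∧ C ≠ C₁ ∧ ¬ Disjoint C₁ C
  obtain ⟨C, hC, hmin⟩ := Finset.exists_min_image 𝓕 (fun C => (C₁ ∪ C).card)
    ⟨C₂, Finset.mem_filter.2 ⟨Finset.mem_powerset.2 hs₂, h₂, hne, hd⟩⟩
  obtain ⟨hCA, hCl, hCne, hCd⟩ := Finset.mem_filter.1 hC
  rw [Finset.mem_powerset] at hCA
  have sgn : ∀ x ∈ C₁, ∀ j, x j = 0 ∨ x j = 1 ∨ x j = -1 := fun x hx => hA.1.2 x (hs₁ hx)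
  have heven := h₁.evenSum.symmDiff sgn hCl.evenSum
  have hl : ∀ D ⊆ C₁ ∪ C, IsTELace D → D = C₁ ∨ D = C ∨ D = C₁ ∆ C := by
    intro D hD hDl
    by_cases hDne : D = C₁
    · exact Or.inl hDne
    right
    have hDd : ¬ Disjoint C₁ D := by
      intro hdis
      have hDC : D ⊆ C := fun x hx => (Finset.mem_union.1 (hD hx)).resolve_left fun h =>
        Finset.disjoint_left.1 hdis h hx
      rw [hCl.eq_of_subset hDl.2.1 hDC] at hdis
      exact hCd hdis
    have hDA : D ⊆ A := hD.trans (Finset.union_subset hs₁ hCA)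
    have h3 := hmin D (Finset.mem_filter.2 ⟨Finset.mem_powerset.2 hDA, hDl, hDne, hDd⟩)
    have h4 : C₁ ∪ D = C₁ ∪ C :=
      Finset.eq_of_subset_of_card_le (Finset.union_subset Finset.subset_union_left hD) h3
    have h5 : D ∆ C ⊆ C₁ := by
      intro x hx
      by_contra hx1
      have h6 : x ∈ D ↔ x ∈ C := by
        have := Finset.ext_iff.1 h4 x
        simpa [hx1] using this
      rcases Finset.mem_symmDiff.1 hx with h | h <;> tauto
    by_cases h6 : (D ∆ C).Nonempty
    · have h7 := (hDl.evenSum.symmDiff (fun x hx => hA.1.2 x (hDA hx)) hCl.evenSum).not_isTUSet h6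
      have h8 := h₁.eq_of_subset h7 h5
      right
      rw [← h8, symmDiff_symmDiff_cancel_right]
    · left
      rw [Finset.not_nonempty_iff_eq_empty] at h6
      exact symmDiff_eq_bot.1 h6
  obtain ⟨a, ha1, ha2⟩ := Finset.not_disjoint_iff.1 hCd
  have haI : a ∈ C₁ ∩ C := Finset.mem_inter.2 ⟨ha1, ha2⟩
  obtain ⟨c, hcC⟩ : (C \ C₁).Nonempty := by
    rw [Finset.sdiff_nonempty]
    exact fun h => hCne (h₁.eq_of_subset hCl.2.1 h)
  obtain ⟨p, hp⟩ : (C₁ \ C).Nonempty := by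
    rw [Finset.sdiff_nonempty]
    exact fun h => hCne (hCl.eq_of_subset h₁.2.1 h).symm
  have hcard := Finset.card_inter_add_card_sdiff C₁ C
  have hUA : C₁ ∪ C ⊆ A := Finset.union_subset hs₁ hCA
  by_cases h3 : 1 < (C₁ \ C).card
  · obtain ⟨u, hu, b, hb, hub⟩ := Finset.one_lt_card.1 h3
    exact theta_false hA hUA h₁.evenSum hCl.evenSum hl hub hu hb haI hcC
  · -- Replacing `C` by the symmetric difference exchanges the roles of `C₁ \ C` and `C₁ ∩ C`.
    obtain ⟨u, hu, b, hb, hub⟩ := Finset.one_lt_card.1 (show 1 < (C₁ ∩ C).card by omega)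
    have hU : C₁ ∪ C₁ ∆ C = C₁ ∪ C := by
      ext x; simp only [Finset.mem_union, Finset.mem_symmDiff]; tauto
    rw [Finset.mem_inter] at hu hb
    rw [Finset.mem_sdiff] at hp hcC
    refine theta_false hA (hU ▸ hUA) h₁.evenSum heven (fun D hD hDl => ?_) hub (a := p) (c := c)
      ?_ ?_ ?_ ?_
    · rw [symmDiff_symmDiff_cancel_left]
      rcases hl D (hU ▸ hD) hDl with h | h | h <;> tauto
    all_goals simp only [Finset.mem_sdiff, Finset.mem_inter, Finset.mem_symmDiff]; tauto

end Laces
end Equimod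

/-! ### Unions of mutually-tu bricks -/

namespace Equimod

section Partition

variable {ι : Type*} [Fintype ι]

/-- Modulo `N`, the columns of an interlace `I` reduce to zero or, up to sign, to columns of `I`,
provided that adding a single vector of `I` to a subset of `N` keeps the equideterminant. -/
theorem redSet_col_of_common_support {N I : Finset (ι → ℚ)} (hd : Disjoint N I)
    (hs : ∀ a ∈ I, ∀ j, a j = 0 ∨ a j = 1 ∨ a j = -1)
    (hsupp : ∀ a ∈ I, ∀ b ∈ I, ∀ j, a j ^ 2 = b j ^ 2)
    (h : ∀ N' ⊆ N, ∃ D, EqdSet N' D ∧ ∀ a ∈ I, EqdSet (insert a N') D) {f : N → ι}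
    (hf : IsBase N f) (j : ι) :
    (∀ a ∈ I, redSet N f a j = 0) ∨ ∃ k, ∃ σ : ℚ, (σ = 1 ∨ σ = -1) ∧ (∀ a ∈ I, a k ≠ 0) ∧
      ∀ a ∈ I, redSet N f a j = σ * a k := by
  induction N using Finset.induction_on generalizing j with
  | empty =>
    have h0 : ∀ a, redSet ∅ f a = a := fun a =>
      (redSet_unique hf (by simp) fun i => absurd i.2 (Finset.notMem_empty _)).symm
    simp only [h0]
    by_cases h1 : ∃ a ∈ I, a j = 0
    · left
      obtain ⟨a, ha, h1⟩ := h1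
      intro b hb
      have := hsupp a ha b hb j
      rw [h1] at this
      simpa using this.symm
    · push Not at h1
      exact Or.inr ⟨j, 1, Or.inl rfl, h1, fun a _ => (one_mul _).symm⟩
  | insert u N hu ih =>
    obtain ⟨f₀, k, hf₀, -, -, huk, hred⟩ := hf.exists_tower hu
    rw [Finset.disjoint_insert_left] at hd
    have ih' := ih hd.2 (fun N' hN' => h N' (hN'.trans (Finset.subset_insert _ _))) hf₀
    obtain ⟨δ, hδ, -⟩ := h N (Finset.subset_insert _ _)
    obtain ⟨D, hD, hDa⟩ := h _ subset_rfl
    have hue := (hδ.redSet_entry hu hD hf₀).1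
    -- the entries of the reduced row `u` are all zero or of the same absolute value
    have hω : redSet N f₀ u j / redSet N f₀ u k = 0 ∨ redSet N f₀ u j / redSet N f₀ u k = 1 ∨
        redSet N f₀ u j / redSet N f₀ u k = -1 := by
      rcases hue j with h1 | h1
      · left; rw [h1, zero_div]
      · right
        rw [← (hue k).resolve_left huk] at h1
        rcases abs_eq_abs.1 h1 with h1 | h1
        · left; rw [h1, div_self huk]
        · right; rw [h1, neg_div, div_self huk]
    have hr : ∀ a, redSet (insert u N) f a j =
        redSet N f₀ a j - redSet N f₀ u j / redSet N f₀ u k * redSet N f₀ a k := by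
      intro a
      rw [hred]
      simp only [Pi.sub_apply, Pi.smul_apply, smul_eq_mul]
      ring
    set ω := redSet N f₀ u j / redSet N f₀ u k
    simp only [hr]
    by_cases hω0 : ω = 0
    · simpa [hω0] using ih' j
    have hω' := hω.resolve_left hω0
    rcases ih' j with h1 | ⟨k₁, σ, hσ, hk₁, h1⟩ <;> rcases ih' k with h2 | ⟨k₂, τ, hτ, hk₂, h2⟩
    · left
      intro a ha
      rw [h1 a ha, h2 a ha]
      simp
    · right
      refine ⟨k₂, -ω * τ, ?_, hk₂, fun a ha => ?_⟩
      · rcases hω' with h | h <;> rcases hτ with h' | h' <;> rw [h, h'] <;> norm_num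
      · rw [h1 a ha, h2 a ha]; ring
    · right
      refine ⟨k₁, σ, hσ, hk₁, fun a ha => ?_⟩
      rw [h1 a ha, h2 a ha]; ring
    · left
      intro a ha
      -- a difference of two signs, hence even, but also an entry of absolute value at most `1`
      have haN : a ∉ insert u N := by
        rw [Finset.mem_insert, not_or]
        exact ⟨fun h => hd.1 (h ▸ ha), fun h => Finset.disjoint_left.1 hd.2 h ha⟩
      have h3 := (hD.redSet_entry haN (hDa a ha) hf).1 j
      rw [hr, div_self hD.pos.ne', h1 a ha, h2 a ha] at h3
      rw [h1 a ha, h2 a ha]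
      have s1 := (hs a ha k₁).resolve_left (hk₁ a ha)
      have s2 := (hs a ha k₂).resolve_left (hk₂ a ha)
      rcases h3 with h3 | h3
      · exact h3
      · exfalso
        rcases s1 with s1 | s1 <;> rcases s2 with s2 | s2 <;> rcases hσ with hσ | hσ <;>
        rcases hτ with hτ | hτ <;> rcases hω' with hω' | hω' <;> rw [s1, s2, hσ, hτ, hω'] at h3 <;>
        norm_num at h3

/-- Adding an interlace to a set to which its vectors can be added separately without changing the
equideterminant multiplies the equideterminant by that of the interlace. -/
theorem eqdSet_union_of_common_support {A N I : Finset (ι → ℚ)} (hA : IsIndepSignSet A)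
    (hNI : N ∪ I ⊆ A) (hd : Disjoint N I)
    (hsupp : ∀ a ∈ I, ∀ b ∈ I, ∀ j, a j ^ 2 = b j ^ 2)
    (h : ∀ N' ⊆ N, ∃ D, EqdSet N' D ∧ ∀ a ∈ I, EqdSet (insert a N') D) {D e : ℚ}
    (hD : EqdSet N D) (he : EqdSet I e) : EqdSet (N ∪ I) (D * e) := by
  rw [eqdSet_union hd]
  refine IsEqd.of_red hD (linearIndependent_of_injective hA ?_ ?_) fun f hf g => ?_
  · refine Subtype.val_injective.sumElim Subtype.val_injective fun a b hab => ?_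
    exact Finset.disjoint_left.1 hd a.2 (by rw [hab]; exact b.2)
  · rintro (x | x)
    · exact hNI (Finset.mem_union_left _ x.2)
    · exact hNI (Finset.mem_union_right _ x.2)
  · have key := redSet_col_of_common_support hd
      (fun a ha => hA.2 a (hNI (Finset.mem_union_right _ ha))) hsupp h hf
    by_cases h0 : ∃ i, ∀ a ∈ I, redSet N f a (g i) = 0
    · obtain ⟨i, hi⟩ := h0
      left
      exact Matrix.det_eq_zero_of_column_eq_zero i fun a => hi a a.2
    · push Not at h0
      have h1 : ∀ i : I, ∃ k, ∃ σ : ℚ, (σ = 1 ∨ σ = -1) ∧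
          ∀ a ∈ I, redSet N f a (g i) = σ * a k := by
        intro i
        rcases key (g i) with h2 | ⟨k, σ, hσ, -, h2⟩
        · obtain ⟨a, ha, h3⟩ := h0 i
          exact absurd (h2 a ha) h3
        · exact ⟨k, σ, hσ, h2⟩
      choose k σ hσ hk using h1
      have h2 : minor (red (Subtype.val : N → ι → ℚ) f ∘ (Subtype.val : I → ι → ℚ)) g =
          (∏ i, σ i) * minor (Subtype.val : I → ι → ℚ) k := by
        rw [minor, minor, ← Matrix.det_mul_row]
        congr 1
        ext a i
        exact hk i a a.2
      have h3 : |∏ i, σ i| = 1 := by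
        rw [Finset.abs_prod]
        exact Finset.prod_eq_one fun i _ => by rcases hσ i with h | h <;> rw [h] <;> norm_num
      rw [h2, abs_mul, h3, one_mul]
      rcases he.2 k with h4 | h4
      · left; rw [h4, mul_zero]
      · exact Or.inr h4

open Classical in
/-- The equideterminant of an equimodular set, and `0` for other sets. -/
noncomputable def eqdet (X : Finset (ι → ℚ)) : ℚ :=
  if h : ∃ d, EqdSet X d then h.choose else 0

theorem EqdSet.eqdet_eq {X : Finset (ι → ℚ)} {d : ℚ} (h : EqdSet X d) : eqdet X = d := by
  have h' : ∃ d, EqdSet X d := ⟨d, h⟩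
  rw [eqdet, dif_pos h']
  exact h'.choose_spec.unique h

theorem prod_eqdet_mul {F : Finset (Finset (ι → ℚ))}
    (hd : (F : Set (Finset (ι → ℚ))).PairwiseDisjoint id) {B : Finset (ι → ℚ)} (hB : B ∈ F)
    {Y Y' : Finset (ι → ℚ)} (h : ∀ x, x ∉ B → (x ∈ Y ↔ x ∈ Y')) :
    (∏ C ∈ F, eqdet (Y ∩ C)) * eqdet (Y' ∩ B) = (∏ C ∈ F, eqdet (Y' ∩ C)) * eqdet (Y ∩ B) := by
  rw [← Finset.mul_prod_erase F _ hB, ← Finset.mul_prod_erase F (fun C => eqdet (Y' ∩ C)) hB]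
  have : ∏ C ∈ F.erase B, eqdet (Y ∩ C) = ∏ C ∈ F.erase B, eqdet (Y' ∩ C) := by
    refine Finset.prod_congr rfl fun C hC => ?_
    obtain ⟨hCB, hCF⟩ := Finset.mem_erase.1 hC
    congr 1
    ext x
    simp only [Finset.mem_inter]
    refine and_congr_left fun hx => h x fun hxB => ?_
    exact Finset.disjoint_left.1 (hd hCF hB hCB) hx hxB
  rw [this]
  ring

theorem _root_.IsTEInterlace.sq_eq {I : Finset (ι → ℚ)} (h : IsTEInterlace I) {a b : ι → ℚ}
    (ha : a ∈ I) (hb : b ∈ I) (j : ι) : a j ^ 2 = b j ^ 2 := by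
  by_cases hab : a = b
  · rw [hab]
  · exact (h.2.2 a ha b hb hab).sq_eq j

/-- For a subset of a union of mutually-tu te-bricks, the equideterminant is the product of the
equideterminants of its traces on the bricks. -/
theorem eqdSet_of_partition {A : Finset (ι → ℚ)} (hA : IsIndepSignSet A)
    {F : Finset (Finset (ι → ℚ))} (hF : IsMutuallyTUPartition A F) {Y : Finset (ι → ℚ)}
    (hY : Y ⊆ A) : EqdSet Y (∏ B ∈ F, eqdet (Y ∩ B)) := by
  obtain ⟨hbr, hdis, hsup, hmut⟩ := hF
  have hBA : ∀ B ∈ F, B ⊆ A := fun B hB => hsup ▸ Finset.le_sup (f := id) hB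
  induction Y using Finset.strongInduction with
  | H Y ih =>
    by_cases h1 : ∃ B ∈ F, IsTEInterlace B ∧ 1 < (Y ∩ B).card
    · obtain ⟨B, hB, hBI, hcard⟩ := h1
      have hYe : Y \ B ∪ Y ∩ B = Y := Finset.sdiff_union_inter Y B
      have hdj : Disjoint (Y \ B) (Y ∩ B) := Finset.disjoint_sdiff_inter Y B
      obtain ⟨d, hd⟩ := hBI.1.exists_eqdSet (Finset.inter_subset_right (s₁ := Y))
      have hne : ∀ N' ⊆ Y \ B, ∀ a ∈ Y ∩ B, insert a N' ⊂ Y := by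
        intro N' hN' a ha
        obtain ⟨b, hb, hba⟩ := Finset.exists_mem_ne hcard a
        refine (Finset.insert_subset (Finset.mem_inter.1 ha).1
          (hN'.trans Finset.sdiff_subset)).ssubset_of_ne fun h => ?_
        have : b ∈ insert a N' := h ▸ (Finset.mem_inter.1 hb).1
        exact Finset.disjoint_left.1 hdj (hN' ((Finset.mem_insert.1 this).resolve_left hba)) hb
      obtain ⟨a₀, ha₀⟩ : (Y ∩ B).Nonempty := Finset.card_pos.1 (by omega)
      have hN : ∀ N' ⊆ Y \ B, EqdSet N' (∏ C ∈ F, eqdet (N' ∩ C)) := fun N' hN' =>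
        have := (Finset.subset_insert a₀ N').trans_ssubset (hne N' hN' a₀ ha₀)
        ih N' this (this.subset.trans hY)
      have hNB : ∀ N' ⊆ Y \ B, eqdet (N' ∩ B) = 1 := fun N' hN' => by
        have : N' ∩ B = ∅ := Finset.disjoint_iff_inter_eq_empty.1
          (Finset.sdiff_disjoint.mono_left hN')
        rw [this]
        exact eqdSet_empty.eqdet_eq
      have hNa : ∀ N' ⊆ Y \ B, ∀ a ∈ Y ∩ B, EqdSet (insert a N') (∏ C ∈ F, eqdet (N' ∩ C)) := by
        intro N' hN' a ha
        have h2 := ih _ (hne N' hN' a ha) ((hne N' hN' a ha).subset.trans hY)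
        have haB := (Finset.mem_inter.1 ha).2
        have h3 := prod_eqdet_mul hdis hB (Y := insert a N') (Y' := N') fun x hx => by
          have : x ≠ a := fun h => hx (h ▸ haB)
          simp [this]
        have h4 : insert a N' ∩ B = {a} := by
          rw [Finset.insert_inter_of_mem haB, Finset.disjoint_iff_inter_eq_empty.1
            (Finset.sdiff_disjoint.mono_left hN')]
          rfl
        have h5 : eqdet {a} = 1 := (isTUSet_of_card_le_one (hA.mono
          (Finset.singleton_subset_iff.2 (hBA B hB haB))) (by simp)).eqdSet.eqdet_eq
        rw [hNB N' hN', h4, h5, mul_one, mul_one] at h3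
        rwa [← h3]
      have h6 := eqdSet_union_of_common_support hA (hYe.symm ▸ hY) hdj
        (fun a ha b hb j => hBI.sq_eq (Finset.mem_inter.1 ha).2 (Finset.mem_inter.1 hb).2 j)
        (fun N' hN' => ⟨_, hN N' hN', hNa N' hN'⟩) (hN _ subset_rfl) hd
      rw [hYe] at h6
      convert h6 using 1
      have h7 := prod_eqdet_mul hdis hB (Y := Y) (Y' := Y \ B) fun x hx => by simp [hx]
      rwa [hNB _ subset_rfl, mul_one, hd.eqdet_eq] at h7
    by_cases h2 : ∃ B ∈ F, IsTELace B ∧ B ⊆ Y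
    · obtain ⟨B, hB, hBl, hBY⟩ := h2
      obtain ⟨a, ha, b, hb, hab⟩ := Finset.one_lt_card.1 hBl.two_le_card
      have e : insert a (insert b ((Y.erase a).erase b)) = Y := by
        rw [Finset.insert_erase (Finset.mem_erase.2 ⟨hab.symm, hBY hb⟩),
          Finset.insert_erase (hBY ha)]
      set P := (Y.erase a).erase b with hP
      have haP : a ∉ P := by simp [hP]
      have hbP : b ∉ P := by simp [hP]
      have hPY : P ⊆ Y := (Finset.erase_subset _ _).trans (Finset.erase_subset _ _)
      have hTU : ∀ x ∈ B, ∀ Z, x ∉ Z → eqdet (Z ∩ B) = 1 := fun x hx Z hxZ =>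
        (hBl.2.2 (Z ∩ B) (Finset.inter_subset_right.ssubset_of_ne fun h =>
          hxZ (Finset.mem_inter.1 (h.symm ▸ hx : x ∈ Z ∩ B)).1)).eqdSet.eqdet_eq
      have hprod : ∀ Z ⊆ Y, ∀ x ∈ B, x ∉ Z → P ⊆ Z →
          EqdSet Z (∏ C ∈ F, eqdet (P ∩ C)) := by
        intro Z hZ x hx hxZ hPZ
        have h3 := ih Z (hZ.ssubset_of_ne fun h => hxZ (h ▸ hBY hx)) (hZ.trans hY)
        have h4 := prod_eqdet_mul hdis hB (Y := Z) (Y' := P) fun y hy => by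
          have hya : y ≠ a := fun h => hy (h ▸ ha)
          have hyb : y ≠ b := fun h => hy (h ▸ hb)
          exact ⟨fun h => by simp [hP, hya, hyb, hZ h], fun h => hPZ h⟩
        rw [hTU a ha P haP, hTU x hx Z hxZ, mul_one, mul_one] at h4
        rwa [← h4]
      have hBP : B \ P = {a, b} := by
        ext x
        simp only [hP, Finset.mem_sdiff, Finset.mem_erase, Finset.mem_insert,
          Finset.mem_singleton]
        constructor
        · rintro ⟨h3, h4⟩
          have := hBY h3
          tauto
        · rintro (rfl | rfl) <;> tauto
      have h3 := eqdSet_insert_insert_of_evenSum hA (by rw [e]; exact hY) haP hbP hab hBP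
        hBl.evenSum (hprod P hPY a ha haP subset_rfl)
        (hprod _ (Finset.insert_subset (hBY ha) hPY) b hb (by simp [hab.symm, hbP])
          (Finset.subset_insert _ _))
        (hprod _ (Finset.insert_subset (hBY hb) hPY) a ha (by simp [hab, haP])
          (Finset.subset_insert _ _))
      rw [e] at h3
      convert h3 using 1
      have h4 := prod_eqdet_mul hdis hB (Y := Y) (Y' := P) fun y hy => by
        have hya : y ≠ a := fun h => hy (h ▸ ha)
        have hyb : y ≠ b := fun h => hy (h ▸ hb)
        simp [hP, hya, hyb]
      rwa [hTU a ha P haP, mul_one, Finset.inter_eq_right.2 hBY, hBl.eqdSet.eqdet_eq] at h4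
    · push Not at h1 h2
      have hTU : IsTUSet Y := by
        by_cases h3 : ∃ B ∈ F, ∃ B' ∈ F, B ≠ B' ∧ (Y ∩ B).Nonempty ∧ (Y ∩ B').Nonempty
        · exact hmut Y (hsup ▸ hY) h3 (fun B hB hBl => h2 B hB hBl) fun B hB hBI => h1 B hB hBI
        · rcases Y.eq_empty_or_nonempty with rfl | ⟨y, hy⟩
          · exact isTUSet_of_card_le_one (hA.mono hY) (by simp)
          have hmem : ∀ z ∈ Y, ∃ B ∈ F, z ∈ B := fun z hz => by
            simpa using Finset.mem_sup.1 (hsup.symm ▸ hY hz)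
          obtain ⟨B, hB, hyB⟩ := hmem y hy
          have hYB : Y ⊆ B := by
            intro z hz
            obtain ⟨B', hB', hzB'⟩ := hmem z hz
            by_cases hBB : B = B'
            · exact hBB ▸ hzB'
            · exact absurd ⟨B, hB, B', hB', hBB, ⟨y, Finset.mem_inter.2 ⟨hy, hyB⟩⟩,
                ⟨z, Finset.mem_inter.2 ⟨hz, hzB'⟩⟩⟩ h3
          have hI : IsTEInterlace B → IsTUSet Y := fun h => by
            refine isTUSet_of_card_le_one (hA.mono hY) ?_
            have := h1 B hB h
            rwa [Finset.inter_eq_left.2 hYB] at this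
          rcases hbr B hB with h | h | h | h
          · exact h.mono hYB
          · exact h.2.2 Y (hYB.ssubset_of_ne fun h' => h2 B hB h h'.ge)
          · exact hI h.1
          · exact hI h.1
      have : ∏ B ∈ F, eqdet (Y ∩ B) = 1 := Finset.prod_eq_one fun B _ =>
        (hTU.mono Finset.inter_subset_left).eqdSet.eqdet_eq
      rw [this]
      exact hTU.eqdSet

theorem isTESet_of_partition {A : Finset (ι → ℚ)} (hA : IsIndepSignSet A)
    {F : Finset (Finset (ι → ℚ))} (hF : IsMutuallyTUPartition A F) : IsTESet A :=
  isTESet_iff.2 ⟨hA, fun _ hX => ⟨_, eqdSet_of_partition hA hF hX⟩⟩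

end Partition
end Equimod

/-! ### Equideterminants of te-interlaces -/

namespace Equimod

section Interlaces

variable {ι : Type*} [Fintype ι]

theorem IsBase.injective {N : Finset (ι → ℚ)} {f : N → ι} (hf : IsBase N f) :
    Function.Injective f := by
  intro a b hab
  by_contra hne
  exact hf (Matrix.det_zero_of_column_eq hne fun i => by simp [hab])

theorem two_pow_div_le (k : ℕ) : (2 : ℚ) ^ k / 2 ^ (k - 1) ≤ 2 := by
  cases k with
  | zero => norm_num
  | succ k =>
    rw [Nat.add_sub_cancel, pow_succ]
    field_simp
    exact le_rfl

/-- If a set has equideterminant `2 ^ m` and the proper subsets only have half of what this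
suggests, then its vectors satisfy a relation modulo `4` with coefficients `1, -1`. -/
theorem exists_relation_mod_four {X : Finset (ι → ℚ)} (hX : EqdSet X (2 ^ X.card))
    (h : ∀ Y ⊂ X, EqdSet Y (2 ^ (Y.card - 1))) (h2 : 2 ≤ X.card) :
    ∃ ε : (ι → ℚ) → ℚ, (∀ x ∈ X, ε x = 1 ∨ ε x = -1) ∧
      ∀ j, (∑ x ∈ X, ε x • x) j ∈ AddSubgroup.zmultiples (4 : ℚ) := by
  classical
  obtain ⟨k, hk⟩ : ∃ k, X.card = k + 2 := ⟨X.card - 2, by omega⟩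
  obtain ⟨s, hs⟩ : X.Nonempty := Finset.card_pos.1 (by omega)
  have hE : ∀ r ∈ X, EqdSet (X.erase r) (2 ^ k) := fun r hr => by
    have := h _ (Finset.erase_ssubset hr)
    rwa [Finset.card_erase_of_mem hr, hk, show k + 2 - 1 - 1 = k by omega] at this
  obtain ⟨f, hf⟩ := (hE s hs).exists_isBase
  have hsN := Finset.notMem_erase s X
  obtain ⟨h1, -⟩ := (hE s hs).redSet_entry hsN (by rwa [Finset.insert_erase hs]) hf
  have h4 : ∀ j, redSet (X.erase s) f s j ∈ AddSubgroup.zmultiples (4 : ℚ) := fun j => by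
    have e : (2 : ℚ) ^ X.card / 2 ^ k = 4 := by rw [hk, pow_add]; field_simp; norm_num
    rcases h1 j with h5 | h5
    · rw [h5]; exact zero_mem _
    · rw [e] at h5
      rcases (abs_eq (by norm_num)).1 h5 with h5 | h5 <;> rw [h5]
      · exact AddSubgroup.mem_zmultiples _
      · exact neg_mem (AddSubgroup.mem_zmultiples _)
  obtain ⟨c, hc, hc2⟩ := (hE s hs).exists_row_coeff hf hsN
  have hc3 : ∀ r ∈ X.erase s, c r = 1 ∨ c r = -1 := by
    intro r hr
    obtain ⟨hrs, hrX⟩ := Finset.mem_erase.1 hr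
    have e : insert s ((X.erase s).erase r) = X.erase r := by
      rw [Finset.erase_right_comm, Finset.insert_erase (Finset.mem_erase.2 ⟨hrs.symm, hs⟩)]
    have h5 := hc2 r hr _ (by rw [e]; exact hE r hrX)
    rw [div_self (by positivity)] at h5
    refine (sign_of_abs h5).resolve_left fun h6 => ?_
    have hN' := h ((X.erase s).erase r) (((Finset.erase_subset _ _).trans_ssubset
      (Finset.erase_ssubset hs)))
    have h7 := hN'.le_div (s := s) (by simp) (by rw [e]; exact hE r hrX) h4 (by
      rw [hc, sub_sub_cancel, ← Finset.add_sum_erase _ _ hr, h6, zero_smul, zero_add]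
      exact Submodule.sum_mem _ fun y hy => Submodule.smul_mem _ _ (Submodule.subset_span hy))
    rw [Finset.card_erase_of_mem hr, Finset.card_erase_of_mem hs, hk,
      show k + 2 - 1 - 1 - 1 = k - 1 by omega] at h7
    have := two_pow_div_le k
    linarith
  refine ⟨fun x => if x = s then 1 else -c x, fun x hx => ?_, fun j => ?_⟩
  · by_cases hxs : x = s
    · simp [hxs]
    · simp only [hxs, if_false]
      rcases hc3 x (Finset.mem_erase.2 ⟨hxs, hx⟩) with h | h <;> rw [h] <;> norm_num
  · convert h4 j using 1
    have h5 : ∑ x ∈ X.erase s, (if x = s then (1 : ℚ) else -c x) • x =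
        -∑ x ∈ X.erase s, c x • x := by
      rw [← Finset.sum_neg_distrib]
      refine Finset.sum_congr rfl fun x hx => ?_
      rw [if_neg (Finset.ne_of_mem_erase hx), neg_smul]
    rw [hc, ← Finset.add_sum_erase _ _ hs, h5]
    simp [sub_eq_add_neg]

variable {I : Finset (ι → ℚ)}

/-- At most one of the maximal proper subsets of an interlace can have the larger
equideterminant. -/
theorem not_eqdSet_two_pow_erase (hI : IsTESet I)
    (hsupp : ∀ a ∈ I, ∀ b ∈ I, ∀ j, a j ^ 2 = b j ^ 2) {u r : ι → ℚ} (hu : u ∈ I) (hr : r ∈ I)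
    (hur : u ≠ r) (h3 : 3 ≤ I.card)
    (hthin : ∀ x ∈ I, ∀ Y ⊂ I.erase x, EqdSet Y (2 ^ (Y.card - 1)))
    (h1 : EqdSet (I.erase u) (2 ^ (I.erase u).card))
    (h2 : EqdSet (I.erase r) (2 ^ (I.erase r).card)) : False := by
  obtain ⟨ε, hε, hε4⟩ := exists_relation_mod_four h1 (hthin u hu)
    (by rw [Finset.card_erase_of_mem hu]; omega)
  obtain ⟨ε', hε', hε'4⟩ := exists_relation_mod_four h2 (hthin r hr)
    (by rw [Finset.card_erase_of_mem hr]; omega)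
  have hru : r ∈ I.erase u := Finset.mem_erase.2 ⟨hur.symm, hr⟩
  have hur' : u ∈ I.erase r := Finset.mem_erase.2 ⟨hur, hu⟩
  set N := (I.erase u).erase r with hN
  have hN' : (I.erase r).erase u = N := Finset.erase_right_comm
  have hNI : N ⊆ I := (Finset.erase_subset _ _).trans (Finset.erase_subset _ _)
  have hpair : EqdSet (insert u {r}) 2 :=
    (isTELace_pair hI hu hr hur (hsupp u hu r hr)).eqdSet
  have hsingle : EqdSet {r} 1 := (isTUSet_of_card_le_one (hI.1.mono
    (Finset.singleton_subset_iff.2 hr)) (by simp)).eqdSet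
  -- Modulo `4` the even multiples of the vectors of the interlace agree, which eliminates all
  -- vectors but `u` and `r` from the difference of the two relations.
  have hv : ∀ j, (ε' u * (ε' u * u j - ε r * r j + ∑ x ∈ N, (ε' x - ε x) * r j)) ∈
      AddSubgroup.zmultiples (4 : ℚ) := by
    intro j
    have e1 := hε4 j
    have e2 := hε'4 j
    rw [← Finset.add_sum_erase _ _ hru] at e1
    rw [← Finset.add_sum_erase _ _ hur', hN'] at e2
    have e3 : ∑ x ∈ N, (ε' x - ε x) * (x j - r j) ∈ AddSubgroup.zmultiples (4 : ℚ) := by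
      refine sum_mem fun x hx => ?_
      obtain ⟨hxr, hxu⟩ := Finset.mem_erase.1 hx
      have m4 := AddSubgroup.mem_zmultiples (4 : ℚ)
      have hx1 := hε x hxu
      have hx2 := hε' x (Finset.mem_erase.2 ⟨hxr, hNI hx⟩)
      have hsq := hsupp x (hNI hx) r hr j
      rcases hI.1.2 x (hNI hx) j with h | h | h <;> rcases hI.1.2 r hr j with h' | h' | h' <;>
      rw [h, h'] at hsq <;> norm_num at hsq <;> rcases hx1 with hx1 | hx1 <;>
      rcases hx2 with hx2 | hx2 <;> rw [h, h', hx1, hx2] <;> norm_num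
    have e4 := sub_mem (sub_mem e2 e1) e3
    have e5 : (ε' u • u + ∑ x ∈ N, ε' x • x) j - (ε r • r + ∑ x ∈ N, ε x • x) j -
        ∑ x ∈ N, (ε' x - ε x) * (x j - r j) =
        ε' u * u j - ε r * r j + ∑ x ∈ N, (ε' x - ε x) * r j := by
      simp only [Pi.add_apply, Pi.smul_apply, Finset.sum_apply, smul_eq_mul, mul_sub, sub_mul,
        Finset.sum_sub_distrib]
      ring
    rw [e5] at e4
    rcases hε' u hur' with h | h
    · rw [h] at e4 ⊢
      simpa using e4
    · rw [h] at e4 ⊢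
      rw [neg_one_mul]
      exact neg_mem e4
  have h4 := hsingle.le_div (s := u)
    (v := fun j => ε' u * (ε' u * u j - ε r * r j + ∑ x ∈ N, (ε' x - ε x) * r j))
    (by simpa using hur) hpair hv (by
      have hu2 : ε' u * ε' u = 1 := by rcases hε' u hur' with h | h <;> rw [h] <;> norm_num
      rw [Finset.coe_singleton, Submodule.mem_span_singleton]
      refine ⟨ε' u * (ε r - ∑ x ∈ N, (ε' x - ε x)), ?_⟩
      ext j
      simp only [Pi.smul_apply, Pi.sub_apply, smul_eq_mul, ← Finset.sum_mul]
      linear_combination (u j) * hu2)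
  norm_num at h4

/-- Let `u` be added to a set `Z` of the larger equideterminant. On any basis of columns of `Z`, the
vector `u` is a combination of the vectors of `Z` in which all coefficients are `1/2` or `-1/2`. -/
theorem exists_half_coeff
    (hsupp : ∀ a ∈ I, ∀ b ∈ I, ∀ j, a j ^ 2 = b j ^ 2) {u : ι → ℚ} {Z : Finset (ι → ℚ)} {k : ℕ}
    (hu : u ∉ Z) (hZI : insert u Z = I) (hk : Z.card = k + 2) (hZ : EqdSet Z (2 ^ (k + 2)))
    (hthin : ∀ Y ⊂ I, Y ≠ Z → EqdSet Y (2 ^ (Y.card - 1))) {J : Z → ι} (hJ : IsBase Z J) :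
    ∃ c : (ι → ℚ) → ℚ, redSet Z J u = u - ∑ r ∈ Z, c r • r ∧ ∀ r ∈ Z, |c r| = 1 / 2 := by
  obtain ⟨c, hc, hc2⟩ := hZ.exists_row_coeff hJ hu
  have hc3 : ∀ r ∈ Z, c r = 0 ∨ |c r| = 1 / 2 := by
    intro r hr
    have hcard : (insert u (Z.erase r)).card = k + 2 := by
      rw [Finset.card_insert_of_notMem fun h => hu (Finset.mem_of_mem_erase h),
        Finset.card_erase_of_mem hr, hk]
      omega
    have h1 := hthin (insert u (Z.erase r)) (by
      rw [← hZI]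
      refine (Finset.insert_subset_insert _ (Finset.erase_subset _ _)).ssubset_of_ne fun h => ?_
      have := congrArg Finset.card h
      rw [hcard, Finset.card_insert_of_notMem hu, hk] at this
      omega) fun h => hu (h ▸ Finset.mem_insert_self _ _)
    rw [hcard] at h1
    have h2 := hc2 r hr _ h1
    rw [show (2 : ℚ) ^ (k + 2 - 1) / 2 ^ (k + 2) = 1 / 2 by
      rw [show k + 2 - 1 = k + 1 by omega, pow_succ, pow_add]; field_simp] at h2
    exact h2
  refine ⟨c, hc, fun s hs => (hc3 s hs).resolve_left fun hcs => ?_⟩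
  have hzero : ∀ i, (u - ∑ r ∈ Z, c r • r) (J i) = 0 := fun i => by
    rw [← hc]; exact redSet_apply_col hJ u i
  obtain ⟨r₀, hr₀, hcr₀⟩ : ∃ r ∈ Z, c r ≠ 0 := by
    by_contra hall
    push Not at hall
    have h1 : ∑ r ∈ Z, c r • r = 0 := Finset.sum_eq_zero fun r hr => by rw [hall r hr, zero_smul]
    have h2 := hzero ⟨s, hs⟩
    rw [h1, sub_zero] at h2
    refine hJ (Matrix.det_eq_zero_of_column_eq_zero ⟨s, hs⟩ fun a => ?_)
    have h3 := hsupp a (hZI ▸ Finset.mem_insert_of_mem a.2) u (hZI ▸ Finset.mem_insert_self _ _)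
      (J ⟨s, hs⟩)
    rw [h2] at h3
    simpa using h3
  have hne : r₀ ≠ s := fun h => hcr₀ (h ▸ hcs)
  -- Reduce modulo the vectors of `Z` other than `s` and `r₀`, within the columns `J`.
  have hr₀' : r₀ ∈ Z.erase s := Finset.mem_erase.2 ⟨hne, hr₀⟩
  set N := (Z.erase s).erase r₀ with hN
  have hNZ : insert s (insert r₀ N) = Z := by
    rw [hN, Finset.insert_erase hr₀', Finset.insert_erase hs]
  have hs' : s ∉ insert r₀ N := by rw [hN, Finset.insert_erase hr₀']; simp
  have hr₀N : r₀ ∉ N := by simp [hN]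
  have huN : u ∉ N := fun h => hu (Finset.mem_of_mem_erase (Finset.mem_of_mem_erase h))
  have hcardN : N.card = k := by
    rw [hN, Finset.card_erase_of_mem hr₀', Finset.card_erase_of_mem hs, hk]; omega
  have hcol : ∃ f₀ k, IsBase N f₀ ∧ (∀ i, ∃ i', f₀ i = J i') ∧ (∃ i', k = J i') ∧
      redSet N f₀ r₀ k ≠ 0 := by
    clear_value N
    subst hNZ
    obtain ⟨f₁, -, hf₁, h1, -, -, -⟩ := hJ.exists_tower hs'
    obtain ⟨f₀, k, hf₀, h2, ⟨i, hi⟩, h3, -⟩ := hf₁.exists_tower hr₀N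
    refine ⟨f₀, k, hf₀, fun i => ?_, hi ▸ h1 i, h3⟩
    obtain ⟨i', hi'⟩ := h2 i
    exact hi' ▸ h1 i'
  obtain ⟨f₀, j, hf₀, h1, ⟨i, rfl⟩, h2⟩ := hcol
  have hsub : ∀ x ∈ I, x ≠ s → x ∉ N → EqdSet (insert x N) (2 ^ k) := by
    intro x hx hxs hxN
    have hcard : (insert x N).card = k + 1 := by
      rw [Finset.card_insert_of_notMem hxN, hcardN]
    have hNI : N ⊆ I := fun y hy => hZI ▸ Finset.mem_insert_of_mem
      (Finset.mem_of_mem_erase (Finset.mem_of_mem_erase hy))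
    have h3 := hthin (insert x N) ((Finset.insert_subset hx hNI).ssubset_of_ne fun h => by
        have := congrArg Finset.card h
        rw [hcard, ← hZI, Finset.card_insert_of_notMem hu, hk] at this
        omega) fun h => by
      have := congrArg Finset.card h
      rw [hcard, hk] at this
      omega
    rwa [hcard] at h3
  have hNe := hthin N (by
    rw [← hZI]
    refine (((Finset.erase_subset _ _).trans (Finset.erase_subset _ _)).trans
      (Finset.subset_insert _ _)).ssubset_of_ne fun h => ?_
    exact huN (by rw [hN, h]; exact Finset.mem_insert_self _ _)) fun h => by
      have := congrArg Finset.card h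
      omega
  have hus : u ≠ s := fun h => hu (h ▸ hs)
  have hru := (hNe.redSet_entry huN (hsub u (hZI ▸ Finset.mem_insert_self _ _) hus huN) hf₀).1
    (J i)
  have hrr := ((hNe.redSet_entry hr₀N (hsub r₀ (hZI ▸ Finset.mem_insert_of_mem hr₀) hne hr₀N)
    hf₀).1 (J i)).resolve_left h2
  have hy : redSet N f₀ (u - ∑ r ∈ Z, c r • r) = u - ∑ r ∈ Z, c r • r :=
    (redSet_unique hf₀ (by simp) fun i => by
      obtain ⟨i', hi'⟩ := h1 i
      rw [hi']
      exact hzero i').symm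
  have hy2 : redSet N f₀ (u - ∑ r ∈ Z, c r • r) = redSet N f₀ u - c r₀ • redSet N f₀ r₀ := by
    rw [← Finset.add_sum_erase _ _ hs, hcs, zero_smul, zero_add, ← Finset.add_sum_erase _ _ hr₀',
      map_sub, map_add, map_smul, map_sum, Finset.sum_eq_zero (s := (Z.erase s).erase r₀), add_zero]
    intro x hx
    rw [map_smul, redSet_of_mem hf₀ hx, smul_zero]
  have h3 : redSet N f₀ u (J i) = c r₀ * redSet N f₀ r₀ (J i) := by
    have h4 := hzero i
    rw [← hy, hy2] at h4
    simp only [Pi.sub_apply, Pi.smul_apply, smul_eq_mul] at h4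
    linarith
  rw [h3, abs_mul, hrr, (hc3 r₀ hr₀).resolve_left hcr₀] at hru
  have hpos : (0 : ℚ) < 2 ^ k / 2 ^ (N.card - 1) := by positivity
  rcases hru with h4 | h4
  · exact (mul_ne_zero hcr₀ h2) h4
  · linarith

/-- An interlace of the larger equideterminant cannot be extended. -/
theorem not_eqdSet_two_pow_of_insert (hI : IsTESet I)
    (hsupp : ∀ a ∈ I, ∀ b ∈ I, ∀ j, a j ^ 2 = b j ^ 2) {u : ι → ℚ} {Z : Finset (ι → ℚ)} {k : ℕ}
    (hu : u ∉ Z) (hZI : insert u Z = I) (hk : Z.card = k + 2) (hZ : EqdSet Z (2 ^ (k + 2)))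
    (hthin : ∀ Y ⊂ I, Y ≠ Z → EqdSet Y (2 ^ (Y.card - 1))) : False := by
  classical
  have hZI' : Z ⊆ I := hZI ▸ Finset.subset_insert _ _
  have huI : u ∈ I := hZI ▸ Finset.mem_insert_self _ _
  have hIcard : I.card = k + 3 := by rw [← hZI, Finset.card_insert_of_notMem hu, hk]
  have hE : ∀ r ∈ Z, EqdSet (Z.erase r) (2 ^ k) := fun r hr => by
    have h1 : (Z.erase r).card = k + 1 := by rw [Finset.card_erase_of_mem hr, hk]; omega
    have h2 := hthin (Z.erase r) ((Finset.erase_ssubset hr).trans_subset hZI')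
      (Finset.erase_ssubset hr).ne
    rwa [h1] at h2
  have hIE : ∀ r ∈ Z, EqdSet (I.erase r) (2 ^ (k + 1)) := fun r hr => by
    have h2 := hthin (I.erase r) (Finset.erase_ssubset (hZI' hr)) fun h => by
      have : u ∈ I.erase r := Finset.mem_erase.2 ⟨fun h => hu (h ▸ hr), huI⟩
      exact hu (h ▸ this)
    rwa [Finset.card_erase_of_mem (hZI' hr), hIcard, show k + 3 - 1 - 1 = k + 1 by omega] at h2
  obtain ⟨d, hd⟩ := hI.exists_eqdSet subset_rfl
  obtain ⟨a, ha, b, hb, hab⟩ := Finset.one_lt_card.1 (show 1 < Z.card by omega)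
  have hpk : (0 : ℚ) < 2 ^ k := by positivity
  have hpk1 : (2 : ℚ) ^ (k + 1) = 2 * 2 ^ k := by rw [pow_succ, mul_comm]
  have hpk2 : (2 : ℚ) ^ (k + 2) = 4 * 2 ^ k := by rw [pow_add]; ring
  rw [hpk2] at hZ
  -- Comparing the two ways of adding the last two vectors leaves only the thick value `2 ^ |I|`.
  have hd8 : d = 8 * 2 ^ k := by
    have hba : b ∈ I.erase a := Finset.mem_erase.2 ⟨hab.symm, hZI' hb⟩
    have h1 : EqdSet ((I.erase a).erase b) (2 ^ k) := by
      have h1 : ((I.erase a).erase b).card = k + 1 := by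
        rw [Finset.card_erase_of_mem hba, Finset.card_erase_of_mem (hZI' ha), hIcard]; omega
      have h2 := hthin ((I.erase a).erase b) ((Finset.erase_subset _ _).trans_ssubset
        (Finset.erase_ssubset (hZI' ha))) fun h => by
          have := congrArg Finset.card h
          omega
      rwa [h1] at h2
    have e1 : insert b ((I.erase a).erase b) = I.erase a := Finset.insert_erase hba
    have e2 : insert a ((I.erase a).erase b) = I.erase b := by
      rw [Finset.erase_right_comm, Finset.insert_erase (Finset.mem_erase.2 ⟨hab, hZI' ha⟩)]
    have e3 : insert a (insert b ((I.erase a).erase b)) = I := by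
      rw [e1, Finset.insert_erase (hZI' ha)]
    have h2 := h1.mul_eq_or (x := a) (y := b) (by simp) (by simp) hab
      (by rw [e2]; exact hIE b hb) (by rw [e1]; exact hIE a ha) (by rw [e3]; exact hd)
    have hub : u ≠ b := fun h => hu (h ▸ hb)
    have e4 : insert u (Z.erase b) = I.erase b := by
      rw [← hZI, Finset.erase_insert_of_ne hub]
    have h3 := (hE b hb).mul_eq_or (x := u) (y := b) (fun h => hu (Finset.mem_of_mem_erase h))
      (by simp) hub (by rw [e4]; exact hIE b hb) (by rw [Finset.insert_erase hb]; exact hZ)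
      (by rw [Finset.insert_erase hb, hZI]; exact hd)
    rw [hpk1] at h2 h3
    have c : ∀ t : ℚ, d * 2 ^ k = t * 2 ^ k * 2 ^ k → d = t * 2 ^ k := fun t ht =>
      mul_right_cancel₀ hpk.ne' ht
    rcases h2 with h2 | h2
    · have h4 := c 4 (by rw [h2]; ring)
      rcases h3 with h3 | h3
      · exact c 8 (by rw [h3]; ring)
      · have h5 := c 16 (by rw [h3]; ring)
        linarith
    · exact c 8 (by rw [h2]; ring)
  obtain ⟨J, hJ⟩ := hZ.exists_isBase
  obtain ⟨hue, m, hm⟩ := hZ.redSet_entry hu (by rw [hZI]; exact hd) hJ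
  have hm2 : |redSet Z J u m| = 2 := by
    rw [(hue m).resolve_left hm, hd8]; field_simp; norm_num
  -- Exchange a column of the basis for `m`.
  obtain ⟨i, hi⟩ : ∃ i, IsBase Z (Function.update J i m) := by
    by_contra hall
    push Not at hall
    have h1 : ∀ x, redSet Z J x m = x m := fun x => by
      have h2 := red_apply_cramer_cols hJ x m
      rw [Finset.sum_eq_zero, sub_zero] at h2
      · exact h2
      · intro i _
        have : minor (Subtype.val : Z → ι → ℚ) (Function.update J i m) = 0 := not_not.1 (hall i)
        rw [this]
        simp
    have h2 : a m = 0 := by rw [← h1 a, redSet_of_mem hJ ha]; rfl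
    have h3 := hsupp a (hZI' ha) u huI m
    rw [h2] at h3
    exact hm (by rw [h1]; simpa using h3.symm)
  obtain ⟨c, hc, hc2⟩ := exists_half_coeff hsupp hu hZI hk (by rw [hpk2]; exact hZ) hthin hJ
  obtain ⟨c', hc', hc2'⟩ := exists_half_coeff hsupp hu hZI hk (by rw [hpk2]; exact hZ) hthin hi
  -- The difference of the two combinations is an integral combination of `Z` that vanishes on the
  -- columns `J` except one, where it is `± 2`.
  set y := ∑ r ∈ Z, (c' r - c r) • r with hy
  have hy2 : y = redSet Z J u - redSet Z (Function.update J i m) u := by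
    rw [hy, hc, hc']
    simp only [sub_smul, Finset.sum_sub_distrib]
    abel
  have hyJ : ∀ i', J i' ≠ J i → y (J i') = 0 := by
    intro i' hii
    have hne : i' ≠ i := fun h => hii (h ▸ rfl)
    have h1 := redSet_apply_col hi u i'
    rw [Function.update_of_ne hne] at h1
    rw [hy2, Pi.sub_apply, redSet_apply_col hJ, h1, sub_zero]
  have hym : |y m| = 2 := by
    have h1 := redSet_apply_col hi u i
    rw [Function.update_self] at h1
    rw [hy2, Pi.sub_apply, h1, sub_zero, hm2]
  have hyspan : y ∈ Submodule.span ℚ (Z : Set (ι → ℚ)) :=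
    Submodule.sum_mem _ fun r hr => Submodule.smul_mem _ _ (Submodule.subset_span hr)
  have hyi : |y (J i)| = 2 := by
    obtain ⟨w, hw, hw2⟩ := hZ.exists_col_coeff hJ
    have h1 := hw2 y m
    rw [redSet_eq_zero hJ hyspan, Finset.sum_eq_single i (fun i' _ h => by
      rw [hyJ i' fun h' => h (hJ.injective h'), mul_zero]) (by simp)] at h1
    have h2 : y m = w i m * y (J i) := by
      rw [Pi.zero_apply] at h1; linarith
    rw [h2] at hym
    rcases hw i m with h | h | h <;> rw [h] at hym
    · norm_num at hym
    · rwa [one_mul] at hym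
    · rwa [neg_one_mul, abs_neg] at hym
  obtain ⟨s, hs, hcs⟩ : ∃ s ∈ Z, c' s - c s ≠ 0 := by
    by_contra hall
    push Not at hall
    have : y = 0 := Finset.sum_eq_zero fun r hr => by rw [hall r hr, zero_smul]
    rw [this] at hym
    norm_num at hym
  have hcs1 : |c' s - c s| = 1 := by
    rcases (abs_eq (by norm_num)).1 (hc2 s hs) with h | h <;>
    rcases (abs_eq (by norm_num)).1 (hc2' s hs) with h' | h' <;> rw [h, h'] at hcs ⊢ <;>
    norm_num at hcs <;> norm_num
  -- The contradiction is found on the entry of `y` reduced modulo `Z \ {s}`.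
  have htower : ∃ f₀ k, IsBase (Z.erase s) f₀ ∧ (∀ i, ∃ i', f₀ i = J i') ∧ (∃ i', k = J i') ∧
      redSet (Z.erase s) f₀ s k ≠ 0 := by
    have hsE := Finset.notMem_erase s Z
    have hZe := Finset.insert_erase hs
    generalize Z.erase s = X at hsE hZe
    subst hZe
    obtain ⟨f₀, k, hf₀, h1, h2, h3, -⟩ := hJ.exists_tower hsE
    exact ⟨f₀, k, hf₀, h1, h2, h3⟩
  obtain ⟨f₀, n, hf₀, hf₀J, ⟨i', rfl⟩, hn⟩ := htower
  have hse := (((hE s hs).redSet_entry (Finset.notMem_erase s Z)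
    (by rw [Finset.insert_erase hs]; exact hZ) hf₀).1 (J i')).resolve_left hn
  have hred : |redSet (Z.erase s) f₀ y (J i')| = 4 := by
    rw [hy, ← Finset.add_sum_erase _ _ hs, map_add, map_sum, Finset.sum_eq_zero (s := Z.erase s)
      fun x hx => by rw [map_smul, redSet_of_mem hf₀ hx, smul_zero], add_zero, map_smul,
      Pi.smul_apply, smul_eq_mul, abs_mul, hcs1, hse]
    field_simp
  obtain ⟨w, hw, hw2⟩ := (hE s hs).exists_col_coeff hf₀
  rw [hw2] at hred
  by_cases hii : J i' = J i
  · rw [Finset.sum_eq_zero, sub_zero, hii, hyi] at hred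
    · norm_num at hred
    · intro x _
      obtain ⟨i'', hi''⟩ := hf₀J x
      rw [hi'', hyJ i'' fun h => ?_, mul_zero]
      refine hn ?_
      rw [hii, ← h, ← hi'']
      exact redSet_apply_col hf₀ s x
  · rw [hyJ i' hii, zero_sub, abs_neg] at hred
    by_cases hx : ∃ x, f₀ x = J i
    · obtain ⟨x, hx⟩ := hx
      rw [Finset.sum_eq_single x (fun x' _ h => ?_) (by simp), hx, abs_mul, hyi] at hred
      · rcases hw x (J i') with h | h | h <;> rw [h] at hred <;> norm_num at hred
      · obtain ⟨i'', hi''⟩ := hf₀J x'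
        rw [hi'', hyJ i'' fun h' => h (hf₀.injective (by rw [hi'', h', hx])), mul_zero]
    · rw [Finset.sum_eq_zero] at hred
      · norm_num at hred
      · intro x _
        obtain ⟨i'', hi''⟩ := hf₀J x
        rw [hi'', hyJ i'' fun h' => hx ⟨x, by rw [hi'', h']⟩, mul_zero]

/-- The equideterminant of an interlace with `l` vectors is `2 ^ (l - 1)` or `2 ^ l`, and it is
`2 ^ (l' - 1)` for a proper subset with `l'` vectors. -/
theorem eqdSet_two_pow_of_common_support (hI : IsTESet I) (hne : I.Nonempty)
    (hsupp : ∀ a ∈ I, ∀ b ∈ I, ∀ j, a j ^ 2 = b j ^ 2) :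
    (∀ Y ⊂ I, EqdSet Y (2 ^ (Y.card - 1))) ∧
      (EqdSet I (2 ^ (I.card - 1)) ∨ EqdSet I (2 ^ I.card)) := by
  induction I using Finset.strongInduction with
  | H I ih =>
    have hpos := Finset.card_pos.2 hne
    by_cases h1 : I.card = 1
    · have hTU := isTUSet_of_card_le_one hI.1 h1.le
      refine ⟨fun Y hY => ?_, Or.inl ?_⟩
      · have h2 := Finset.card_lt_card hY
        rw [show Y.card - 1 = 0 by omega, pow_zero]
        exact (hTU.mono hY.subset).eqdSet
      · rw [h1]
        simpa using hTU.eqdSet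
    have hIH : ∀ x ∈ I, (∀ Y ⊂ I.erase x, EqdSet Y (2 ^ (Y.card - 1))) ∧
        (EqdSet (I.erase x) (2 ^ ((I.erase x).card - 1)) ∨
          EqdSet (I.erase x) (2 ^ (I.erase x).card)) := fun x hx =>
      ih _ (Finset.erase_ssubset hx) (hI.mono (Finset.erase_subset _ _))
        (Finset.card_pos.1 (by rw [Finset.card_erase_of_mem hx]; omega))
        fun a ha b hb => hsupp a (Finset.mem_of_mem_erase ha) b (Finset.mem_of_mem_erase hb)
    have hsub : ∀ Y ⊂ I, ∃ x ∈ I, Y ⊂ I.erase x ∨ Y = I.erase x := by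
      intro Y hY
      obtain ⟨x, hx, hxY⟩ := Finset.exists_of_ssubset hY
      refine ⟨x, hx, ?_⟩
      have : Y ⊆ I.erase x := fun y hy => Finset.mem_erase.2 ⟨fun h => hxY (h ▸ hy), hY.subset hy⟩
      exact this.eq_or_ssubset.symm
    have hthick : ∀ x ∈ I, ¬ EqdSet (I.erase x) (2 ^ (I.erase x).card) := by
      intro u hu hZ
      have hcard : (I.erase u).card = I.card - 1 := Finset.card_erase_of_mem hu
      by_cases h2 : I.card = 2
      · have hTU := isTUSet_of_card_le_one (hI.1.mono (Finset.erase_subset u I)) (by omega)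
        have := hTU.eqdSet.unique hZ
        rw [hcard, h2] at this
        norm_num at this
      · obtain ⟨k, hk⟩ : ∃ k, (I.erase u).card = k + 2 := ⟨I.card - 3, by omega⟩
        refine not_eqdSet_two_pow_of_insert hI hsupp (Finset.notMem_erase u I)
          (Finset.insert_erase hu) hk (hk ▸ hZ) fun Y hY hYne => ?_
        obtain ⟨x, hx, h3 | rfl⟩ := hsub Y hY
        · exact (hIH x hx).1 Y h3
        · refine (hIH x hx).2.resolve_right fun h3 => ?_
          exact not_eqdSet_two_pow_erase hI hsupp hu hx (fun h => hYne (h ▸ rfl)) (by omega)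
            (fun x hx => (hIH x hx).1) hZ h3
    have hthin : ∀ Y ⊂ I, EqdSet Y (2 ^ (Y.card - 1)) := by
      intro Y hY
      obtain ⟨x, hx, h3 | rfl⟩ := hsub Y hY
      · exact (hIH x hx).1 Y h3
      · exact (hIH x hx).2.resolve_right (hthick x hx)
    refine ⟨hthin, ?_⟩
    obtain ⟨a, ha, b, hb, hab⟩ := Finset.one_lt_card.1 (show 1 < I.card by omega)
    by_cases h2 : I.card = 2
    · left
      have h3 : ({a, b} : Finset (ι → ℚ)) = I := Finset.eq_of_subset_of_card_le
        (Finset.insert_subset ha (Finset.singleton_subset_iff.2 hb))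
        (by rw [Finset.card_pair hab, h2])
      have h4 := (isTELace_pair hI ha hb hab (hsupp a ha b hb)).eqdSet
      rw [h3] at h4
      rw [h2]
      simpa using h4
    · obtain ⟨k, hk⟩ : ∃ k, I.card = k + 3 := ⟨I.card - 3, by omega⟩
      obtain ⟨d, hd⟩ := hI.exists_eqdSet subset_rfl
      have hba : b ∈ I.erase a := Finset.mem_erase.2 ⟨hab.symm, hb⟩
      have hE : ∀ x ∈ I, EqdSet (I.erase x) (2 ^ (k + 1)) := fun x hx => by
        have := hthin _ (Finset.erase_ssubset hx)
        rwa [Finset.card_erase_of_mem hx, hk, show k + 3 - 1 - 1 = k + 1 by omega] at this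
      have hN : EqdSet ((I.erase a).erase b) (2 ^ k) := by
        have := hthin _ ((Finset.erase_subset b _).trans_ssubset (Finset.erase_ssubset ha))
        rwa [Finset.card_erase_of_mem hba, Finset.card_erase_of_mem ha, hk,
          show k + 3 - 1 - 1 - 1 = k by omega] at this
      have e1 : insert b ((I.erase a).erase b) = I.erase a := Finset.insert_erase hba
      have e2 : insert a ((I.erase a).erase b) = I.erase b := by
        rw [Finset.erase_right_comm, Finset.insert_erase (Finset.mem_erase.2 ⟨hab, ha⟩)]
      have h4 := hN.mul_eq_or (x := a) (y := b) (by simp) (by simp) hab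
        (by rw [e2]; exact hE b hb) (by rw [e1]; exact hE a ha)
        (by rw [e1, Finset.insert_erase ha]; exact hd)
      have hpk : (0 : ℚ) < 2 ^ k := by positivity
      have c : ∀ t : ℚ, d * 2 ^ k = t * 2 ^ k * 2 ^ k → d = t * 2 ^ k := fun t ht =>
        mul_right_cancel₀ hpk.ne' ht
      rw [hk, show k + 3 - 1 = k + 2 by omega]
      rcases h4 with h4 | h4
      · left
        have := c 4 (by rw [h4]; ring)
        convert hd using 1
        rw [this]; ring
      · right
        have := c 8 (by rw [h4]; ring)
        convert hd using 1
        rw [this]; ring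

theorem _root_.IsTEInterlace.two_le_card (h : IsTEInterlace I) : 2 ≤ I.card := by
  by_contra hlt
  exact h.2.1 (isTUSet_of_card_le_one h.1.1 (by omega))

theorem _root_.IsTEInterlace.isThin_or_isThick (h : IsTEInterlace I) :
    IsThinTEInterlace I ∨ IsThickTEInterlace I := by
  have h1 := eqdSet_two_pow_of_common_support h.1
    (Finset.card_pos.1 (by have := h.two_le_card; omega)) fun a ha b hb => h.sq_eq ha hb
  exact h1.2.imp (fun h2 => ⟨h, (hasEqdet_iff _ _).2 h2⟩) fun h2 => ⟨h, (hasEqdet_iff _ _).2 h2⟩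

end Interlaces
end Equimod

/-! ### Existence and uniqueness of the decomposition -/

namespace Equimod

section Decomposition

variable {ι : Type*} [Fintype ι]

/-- The vectors of `A` with the same support as `a` (for vectors with entries `0, 1, -1`). -/
def supportClass (A : Finset (ι → ℚ)) (a : ι → ℚ) : Finset (ι → ℚ) :=
  A.filter fun b => ∀ j, a j ^ 2 = b j ^ 2

theorem mem_supportClass {A : Finset (ι → ℚ)} {a b : ι → ℚ} :
    b ∈ supportClass A a ↔ b ∈ A ∧ ∀ j, a j ^ 2 = b j ^ 2 := Finset.mem_filter

theorem supportClass_subset {A : Finset (ι → ℚ)} {a : ι → ℚ} : supportClass A a ⊆ A :=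
  Finset.filter_subset _ _

theorem supportClass_eq {A : Finset (ι → ℚ)} {a b : ι → ℚ} (hb : b ∈ supportClass A a) :
    supportClass A b = supportClass A a := by
  have h := (mem_supportClass.1 hb).2
  ext c
  simp only [mem_supportClass, h]

theorem isTEInterlace_supportClass {A : Finset (ι → ℚ)} (hA : IsTESet A) {a : ι → ℚ}
    (h : 2 ≤ (supportClass A a).card) : IsTEInterlace (supportClass A a) := by
  have hpair : ∀ b ∈ supportClass A a, ∀ c ∈ supportClass A a, b ≠ c → IsTELace {b, c} := by
    intro b hb c hc hbc
    rw [mem_supportClass] at hb hc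
    exact isTELace_pair hA hb.1 hc.1 hbc fun j => (hb.2 j).symm.trans (hc.2 j)
  refine ⟨hA.mono supportClass_subset, fun hTU => ?_, hpair⟩
  obtain ⟨b, hb, c, hc, hbc⟩ := Finset.one_lt_card.1 h
  exact (hpair b hb c hc hbc).2.1
    (hTU.mono (Finset.insert_subset hb (Finset.singleton_subset_iff.2 hc)))

theorem disjoint_supportClass_of_isTELace {A C : Finset (ι → ℚ)} (hA : IsTESet A)
    (hC : IsTELace C) (hCA : C ⊆ A) (h3 : 3 ≤ C.card) {a : ι → ℚ}
    (h : 2 ≤ (supportClass A a).card) : Disjoint C (supportClass A a) := by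
  rw [Finset.disjoint_left]
  intro x hxC hx
  obtain ⟨b, hb, hbx⟩ := Finset.exists_mem_ne h x
  have hl := (isTEInterlace_supportClass hA h).2.2 x hx b hb hbx.symm
  have hne : ({x, b} : Finset (ι → ℚ)) ≠ C := fun h' => by
    rw [← h', Finset.card_pair hbx.symm] at h3
    omega
  exact Finset.disjoint_left.1 (hC.disjoint hA hl hCA (Finset.insert_subset
    (supportClass_subset hx) (Finset.singleton_subset_iff.2 (supportClass_subset hb))) hne h3)
    hxC (by simp)

/-- The te-laces with at least three vectors, the classes with at least two vectors of equal
support, and the remaining vectors form a decomposition. -/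
theorem exists_isTEDecomposition {A : Finset (ι → ℚ)} (hA : IsTESet A) :
    ∃ (U : Finset (ι → ℚ)) (L S T : Finset (Finset (ι → ℚ))), IsTEDecomposition A U L S T := by
  classical
  let L := A.powerset.filter fun C => IsTELace C ∧ 3 ≤ C.card
  let K := (A.image (supportClass A)).filter fun B => 2 ≤ B.card
  let S := K.filter IsThinTEInterlace
  let T := K.filter fun B => ¬ IsThinTEInterlace B
  let U := A \ (L ∪ K).sup id
  have hL : ∀ C, C ∈ L ↔ C ⊆ A ∧ IsTELace C ∧ 3 ≤ C.card := fun C => by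
    simp only [L, Finset.mem_filter, Finset.mem_powerset]
  have hK : ∀ B, B ∈ K ↔ (∃ a ∈ A, supportClass A a = B) ∧ 2 ≤ B.card := fun B => by
    simp only [K, Finset.mem_filter, Finset.mem_image]
  have hST : S ∪ T = K := Finset.filter_union_filter_not_eq _ _
  have hLST : L ∪ S ∪ T = L ∪ K := by rw [Finset.union_assoc, hST]
  have hKI : ∀ B ∈ K, IsTEInterlace B := by
    intro B hB
    obtain ⟨⟨a, -, rfl⟩, h⟩ := (hK B).1 hB
    exact isTEInterlace_supportClass hA h
  have hsub : ∀ B ∈ L ∪ K, B ⊆ A := by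
    intro B hB
    rcases Finset.mem_union.1 hB with hB | hB
    · exact ((hL B).1 hB).1
    · obtain ⟨⟨a, -, rfl⟩, h⟩ := (hK B).1 hB
      exact supportClass_subset
  have hsup : (L ∪ K).sup id ⊆ A := Finset.sup_le hsub
  have hLK : ∀ C ∈ L, ∀ B ∈ K, Disjoint C B := by
    intro C hC B hB
    obtain ⟨⟨a, -, rfl⟩, h⟩ := (hK B).1 hB
    obtain ⟨h1, h2, h3⟩ := (hL C).1 hC
    exact disjoint_supportClass_of_isTELace hA h2 h1 h3 h
  have hLKd : Disjoint L K := by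
    rw [Finset.disjoint_left]
    intro B hB hB'
    have h1 := hLK B hB B hB'
    rw [disjoint_self, Finset.bot_eq_empty] at h1
    have h2 := ((hL B).1 hB).2.2
    rw [h1] at h2
    simp at h2
  have hpw : ((L ∪ K : Finset (Finset (ι → ℚ))) : Set (Finset (ι → ℚ))).PairwiseDisjoint id := by
    intro B hB B' hB' hne
    rw [Finset.mem_coe, Finset.mem_union] at hB hB'
    rcases hB with hB | hB <;> rcases hB' with hB' | hB'
    · obtain ⟨h1, h2, h3⟩ := (hL B).1 hB
      obtain ⟨h1', h2', -⟩ := (hL B').1 hB'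
      exact h2.disjoint hA h2' h1 h1' hne.symm h3
    · exact hLK B hB B' hB'
    · exact (hLK B' hB' B hB).symm
    · obtain ⟨⟨a, -, rfl⟩, -⟩ := (hK B).1 hB
      obtain ⟨⟨b, -, rfl⟩, -⟩ := (hK B').1 hB'
      refine Finset.disjoint_left.2 fun x hx hx' => hne ?_
      exact (supportClass_eq hx).symm.trans (supportClass_eq hx')
  -- A te-lace has at least three vectors or lies in a class of vectors with the same support.
  have hlace : ∀ C ⊆ A, IsTELace C → C ∈ L ∨ ∃ B ∈ K, C ⊆ B := by
    intro C hCA hC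
    by_cases h3 : 3 ≤ C.card
    · exact Or.inl ((hL C).2 ⟨hCA, hC, h3⟩)
    · right
      have h2 := hC.two_le_card
      obtain ⟨a, b, hab, rfl⟩ := Finset.card_eq_two.1 (show C.card = 2 by omega)
      have ha : a ∈ A := hCA (by simp)
      have hs : {a, b} ⊆ supportClass A a := by
        intro x hx
        refine mem_supportClass.2 ⟨hCA hx, fun j => ?_⟩
        rcases Finset.mem_insert.1 hx with rfl | hx
        · rfl
        · rw [Finset.mem_singleton.1 hx]; exact hC.sq_eq j
      exact ⟨_, (hK _).2 ⟨⟨a, ha, rfl⟩, h2.trans (Finset.card_le_card hs)⟩, hs⟩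
  refine ⟨U, L, S, T, ?_, fun B hB => ((hL B).1 hB).2.1, fun B hB => (Finset.mem_filter.1 hB).2,
    fun B hB => ?_, hLKd.mono_right (Finset.filter_subset _ _),
    hLKd.mono_right (Finset.filter_subset _ _), Finset.disjoint_filter_filter_not _ _ _, ?_, ?_, ?_⟩
  · by_contra hU
    obtain ⟨C, hCU, hC⟩ := exists_lace_subset hA Finset.sdiff_subset hU
    obtain ⟨x, hx⟩ : C.Nonempty := Finset.card_pos.1 (by have := hC.two_le_card; omega)
    refine (Finset.mem_sdiff.1 (hCU hx)).2 ?_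
    rcases hlace C (hCU.trans Finset.sdiff_subset) hC with h | ⟨B, hB, hCB⟩
    · exact Finset.le_sup (f := id) (Finset.mem_union_left _ h) hx
    · exact Finset.le_sup (f := id) (Finset.mem_union_right _ hB) (hCB hx)
  · obtain ⟨h1, h2⟩ := Finset.mem_filter.1 hB
    exact (hKI B h1).isThin_or_isThick.resolve_left h2
  · rw [hLST, Finset.coe_insert]
    refine hpw.insert fun B hB _ => ?_
    refine Finset.disjoint_left.2 fun x hx hx' => (Finset.mem_sdiff.1 hx).2 ?_
    exact Finset.le_sup (f := id) hB hx'
  · rw [hLST, Finset.sup_insert]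
    exact Finset.sdiff_union_of_subset hsup
  · rw [hLST]
    intro X hX _ h1 h2
    by_contra hTU
    have hXA : X ⊆ A := by
      rw [Finset.sup_insert] at hX
      exact hX.trans (Finset.union_subset Finset.sdiff_subset hsup)
    obtain ⟨C, hCX, hC⟩ := exists_lace_subset hA hXA hTU
    rcases hlace C (hCX.trans hXA) hC with h | ⟨B, hB, hCB⟩
    · exact h1 C (Finset.mem_insert_of_mem (Finset.mem_union_left _ h)) hC hCX
    · have h3 := h2 B (Finset.mem_insert_of_mem (Finset.mem_union_right _ hB)) (hKI B hB)
      have h4 := hC.two_le_card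
      have h5 := Finset.card_le_card (Finset.subset_inter hCX hCB)
      omega

theorem _root_.IsTEDecomposition.isMutuallyTUPartition {A U : Finset (ι → ℚ)}
    {L S T : Finset (Finset (ι → ℚ))} (h : IsTEDecomposition A U L S T) :
    IsMutuallyTUPartition A (insert U (L ∪ S ∪ T)) := by
  refine ⟨fun B hB => ?_, h.pairwiseDisjoint, h.union_eq, h.mutuallyTU⟩
  simp only [Finset.mem_insert, Finset.mem_union] at hB
  rcases hB with rfl | (hB | hB) | hB
  · exact Or.inl h.tu
  · exact Or.inr (Or.inl (h.laces B hB))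
  · exact Or.inr (Or.inr (Or.inl (h.thin B hB)))
  · exact Or.inr (Or.inr (Or.inr (h.thick B hB)))

theorem _root_.IsTEInterlace.isTELace {B : Finset (ι → ℚ)} (hB : IsTEInterlace B)
    (h : B.card = 2) : IsTELace B := by
  obtain ⟨a, b, hab, rfl⟩ := Finset.card_eq_two.1 h
  exact hB.2.2 a (by simp) b (by simp) hab

/-- A te-lace with two vectors is a thin te-interlace. -/
theorem _root_.IsTELace.isThinTEInterlace {B : Finset (ι → ℚ)} (hB : IsTELace B)
    (h : B.card = 2) : IsThinTEInterlace B := by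
  refine ⟨⟨hB.1, hB.2.1, fun a ha b hb hab => ?_⟩, (hasEqdet_iff _ _).2 ?_⟩
  · have : ({a, b} : Finset (ι → ℚ)) = B := Finset.eq_of_subset_of_card_le
      (Finset.insert_subset ha (Finset.singleton_subset_iff.2 hb))
      (by rw [Finset.card_pair hab, h])
    rwa [this]
  · rw [h]
    simpa using hB.eqdSet

/-- A te-lace that is a te-interlace has two vectors. -/
theorem _root_.IsTELace.card_eq_two {B : Finset (ι → ℚ)} (hB : IsTELace B)
    (hI : IsTEInterlace B) : B.card = 2 := by
  obtain ⟨a, ha, b, hb, hab⟩ := Finset.one_lt_card.1 hB.two_le_card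
  rw [← hB.eq_of_subset (hI.2.2 a ha b hb hab).2.1
    (Finset.insert_subset ha (Finset.singleton_subset_iff.2 hb)), Finset.card_pair hab]

theorem _root_.IsThickTEInterlace.not_isThin {B : Finset (ι → ℚ)} (h : IsThickTEInterlace B) :
    ¬ IsThinTEInterlace B := by
  intro h'
  have h1 := ((hasEqdet_iff _ _).1 h.2).unique ((hasEqdet_iff _ _).1 h'.2)
  have h2 := Nat.pow_right_injective le_rfl (show 2 ^ B.card = 2 ^ (B.card - 1) by
    exact_mod_cast h1)
  have := h.1.two_le_card
  omega

theorem _root_.IsThickTEInterlace.not_isTELace {B : Finset (ι → ℚ)} (h : IsThickTEInterlace B) :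
    ¬ IsTELace B := fun h' => h.not_isThin (h'.isThinTEInterlace (h'.card_eq_two h.1))

section Uniqueness

variable {A U : Finset (ι → ℚ)} {L S T : Finset (Finset (ι → ℚ))}

theorem _root_.IsTEDecomposition.subset (h : IsTEDecomposition A U L S T) {B : Finset (ι → ℚ)}
    (hB : B ∈ L ∪ S ∪ T) : B ⊆ A :=
  h.union_eq ▸ Finset.le_sup (f := id) (Finset.mem_insert_of_mem hB)

theorem _root_.IsTEDecomposition.not_isTUSet (h : IsTEDecomposition A U L S T)
    {B : Finset (ι → ℚ)} (hB : B ∈ L ∪ S ∪ T) : ¬ IsTUSet B := by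
  simp only [Finset.mem_union] at hB
  rcases hB with (hB | hB) | hB
  · exact (h.laces B hB).2.1
  · exact (h.thin B hB).1.2.1
  · exact (h.thick B hB).1.2.1

theorem _root_.IsTEDecomposition.eq_of_mem (h : IsTEDecomposition A U L S T)
    {B B' : Finset (ι → ℚ)} (hB : B ∈ L ∪ S ∪ T) (hB' : B' ∈ L ∪ S ∪ T) {x : ι → ℚ} (hx : x ∈ B)
    (hx' : x ∈ B') : B = B' := by
  by_contra hne
  exact Finset.disjoint_left.1 (h.pairwiseDisjoint (Finset.mem_insert_of_mem hB)
    (Finset.mem_insert_of_mem hB') hne) hx hx'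

theorem _root_.IsTEDecomposition.isTEInterlace (h : IsTEDecomposition A U L S T)
    {B : Finset (ι → ℚ)} (hB : B ∈ S ∪ T) : IsTEInterlace B := by
  rcases Finset.mem_union.1 hB with hB | hB
  · exact (h.thin B hB).1
  · exact (h.thick B hB).1

/-- The minimal non-unimodular subsets of `A` are the te-laces and the pairs in the te-interlaces of
the decomposition. -/
theorem _root_.IsTEDecomposition.mem_or_exists (h : IsTEDecomposition A U L S T)
    {X : Finset (ι → ℚ)} (hXA : X ⊆ A) (hX : IsTELace X) :
    X ∈ L ∨ ∃ B ∈ S ∪ T, X ⊆ B ∧ X.card = 2 := by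
  have hmem : ∀ B, B ∈ insert U (L ∪ S ∪ T) → B = U ∨ B ∈ L ∨ B ∈ S ∪ T := fun B hB => by
    simpa only [Finset.mem_insert, Finset.union_assoc, Finset.mem_union (s := L)] using hB
  have hInt : ∀ B ∈ insert U (L ∪ S ∪ T), IsTEInterlace B → 1 < (X ∩ B).card →
      X ∈ L ∨ ∃ B ∈ S ∪ T, X ⊆ B ∧ X.card = 2 := by
    intro B hB hBI hc
    obtain ⟨a, ha, b, hb, hab⟩ := Finset.one_lt_card.1 hc
    rw [Finset.mem_inter] at ha hb
    have hl := hBI.2.2 a ha.2 b hb.2 hab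
    have hXe := hX.eq_of_subset hl.2.1
      (Finset.insert_subset ha.1 (Finset.singleton_subset_iff.2 hb.1))
    have hXB : X ⊆ B := by
      rw [← hXe]
      exact Finset.insert_subset ha.2 (Finset.singleton_subset_iff.2 hb.2)
    rcases hmem B hB with rfl | hB | hB
    · exact absurd h.tu hBI.2.1
    · left
      rwa [(h.laces B hB).eq_of_subset hX.2.1 hXB]
    · exact Or.inr ⟨B, hB, hXB, by rw [← hXe, Finset.card_pair hab]⟩
  have hLace : ∀ B ∈ insert U (L ∪ S ∪ T), IsTELace B → B ⊆ X →
      X ∈ L ∨ ∃ B ∈ S ∪ T, X ⊆ B ∧ X.card = 2 := by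
    intro B hB hBl hBX
    have hXe := hX.eq_of_subset hBl.2.1 hBX
    rcases hmem B hB with rfl | hB' | hB'
    · exact absurd h.tu hBl.2.1
    · exact Or.inl (hXe ▸ hB')
    · exact Or.inr ⟨B, hB', hXe.ge, hXe ▸ hBl.card_eq_two (h.isTEInterlace hB')⟩
  by_contra hcon
  by_cases h3 : ∃ B ∈ insert U (L ∪ S ∪ T), ∃ B' ∈ insert U (L ∪ S ∪ T), B ≠ B' ∧
      (X ∩ B).Nonempty ∧ (X ∩ B').Nonempty
  · exact hX.2.1 (h.mutuallyTU X (h.union_eq.symm ▸ hXA) h3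
      (fun B hB hBl hBX => hcon (hLace B hB hBl hBX))
      fun B hB hBI => not_lt.1 fun hc => hcon (hInt B hB hBI hc))
  · have hcov : ∀ z ∈ X, ∃ B ∈ insert U (L ∪ S ∪ T), z ∈ B := fun z hz =>
      Finset.mem_sup.1 (h.union_eq.symm ▸ hXA hz)
    obtain ⟨y, hy⟩ : X.Nonempty := Finset.card_pos.1 (by have := hX.two_le_card; omega)
    obtain ⟨B, hB, hyB⟩ := hcov y hy
    have hXB : X ⊆ B := by
      intro z hz
      obtain ⟨B', hB', hzB'⟩ := hcov z hz
      by_cases hBB : B = B'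
      · exact hBB ▸ hzB'
      · exact absurd ⟨B, hB, B', hB', hBB, ⟨y, Finset.mem_inter.2 ⟨hy, hyB⟩⟩,
          ⟨z, Finset.mem_inter.2 ⟨hz, hzB'⟩⟩⟩ h3
    rcases hmem B hB with rfl | hB' | hB'
    · exact hX.2.1 (h.tu.mono hXB)
    · exact hcon (Or.inl ((h.laces B hB').eq_of_subset hX.2.1 hXB ▸ hB'))
    · refine hcon (hInt B hB (h.isTEInterlace hB') ?_)
      rw [Finset.inter_eq_left.2 hXB]
      exact hX.two_le_card

/-- A description of the non-unimodular bricks that only depends on `A`. -/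
theorem _root_.IsTEDecomposition.mem_iff (hA : IsTESet A) (h : IsTEDecomposition A U L S T)
    (B : Finset (ι → ℚ)) :
    B ∈ L ∪ S ∪ T ↔ (B ⊆ A ∧ IsTELace B ∧ B.card ≠ 2) ∨
      ∃ a ∈ A, B = supportClass A a ∧ 2 ≤ B.card := by
  have hLm : ∀ {B}, B ∈ L → B ∈ L ∪ S ∪ T := fun hB =>
    Finset.mem_union_left _ (Finset.mem_union_left _ hB)
  have hSTm : ∀ {B}, B ∈ S ∪ T → B ∈ L ∪ S ∪ T := fun hB => by
    rw [Finset.union_assoc]; exact Finset.mem_union_right _ hB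
  -- two vectors of `A` with the same support lie in the same brick
  have hpair : ∀ {a b}, a ∈ A → b ∈ supportClass A a → a ≠ b →
      ∃ B ∈ L ∪ S ∪ T, a ∈ B ∧ b ∈ B := by
    intro a b ha hb hab
    rw [mem_supportClass] at hb
    have hl := isTELace_pair hA ha hb.1 hab hb.2
    rcases h.mem_or_exists (Finset.insert_subset ha (Finset.singleton_subset_iff.2 hb.1)) hl with
      h1 | ⟨B, hB, hs, -⟩
    · exact ⟨_, hLm h1, by simp, by simp⟩
    · exact ⟨B, hSTm hB, hs (by simp), hs (by simp)⟩
  have hsupp : ∀ {B}, B ∈ L ∪ S ∪ T → (∀ a ∈ B, ∀ b ∈ B, ∀ j, a j ^ 2 = b j ^ 2) → ∀ a ∈ B,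
      B = supportClass A a := by
    intro B hB hs a ha
    have haA := h.subset hB ha
    refine Finset.Subset.antisymm (fun b hb => ?_) fun b hb => ?_
    · exact mem_supportClass.2 ⟨h.subset hB hb, hs a ha b hb⟩
    · by_cases hab : a = b
      · exact hab ▸ ha
      · obtain ⟨B', hB', ha', hb'⟩ := hpair haA hb hab
        rwa [h.eq_of_mem hB hB' ha ha']
  constructor
  · intro hB
    have hI : IsTEInterlace B → ∃ a ∈ A, B = supportClass A a ∧ 2 ≤ B.card := fun hBI => by
      have h2 := hBI.two_le_card
      obtain ⟨a, ha⟩ : B.Nonempty := Finset.card_pos.1 (by omega)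
      exact ⟨a, h.subset hB ha, hsupp hB (fun a ha b hb => hBI.sq_eq ha hb) a ha, h2⟩
    rw [Finset.union_assoc, Finset.mem_union] at hB
    rcases hB with hB' | hB'
    · have hBl := h.laces B hB'
      by_cases h2 : B.card = 2
      · exact Or.inr (hI (hBl.isThinTEInterlace h2).1)
      · exact Or.inl ⟨h.subset (hLm hB'), hBl, h2⟩
    · exact Or.inr (hI (h.isTEInterlace hB'))
  · rintro (⟨hBA, hBl, h2⟩ | ⟨a, ha, rfl, h2⟩)
    · rcases h.mem_or_exists hBA hBl with h1 | ⟨-, -, -, h1⟩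
      · exact hLm h1
      · exact absurd h1 h2
    · obtain ⟨b, hb, hba⟩ := Finset.exists_mem_ne h2 a
      obtain ⟨B, hB, haB, hbB⟩ := hpair ha hb hba.symm
      have hs : ∀ x ∈ B, ∀ y ∈ B, ∀ j, x j ^ 2 = y j ^ 2 := by
        have hl := isTELace_pair hA ha (mem_supportClass.1 hb).1 hba.symm (mem_supportClass.1 hb).2
        have hsub : {a, b} ⊆ B := Finset.insert_subset haB (Finset.singleton_subset_iff.2 hbB)
        have hB' := hB
        rw [Finset.union_assoc, Finset.mem_union] at hB'
        rcases hB' with hB' | hB'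
        · have hBl := h.laces B hB'
          have he := hBl.eq_of_subset hl.2.1 hsub
          have hc : B.card = 2 := by rw [← he, Finset.card_pair hba.symm]
          intro x hx y hy
          exact (hBl.isThinTEInterlace hc).1.sq_eq hx hy
        · intro x hx y hy
          exact (h.isTEInterlace hB').sq_eq hx hy
      exact hsupp hB hs a haB ▸ hB

theorem _root_.IsTEDecomposition.mem_laces_iff (h : IsTEDecomposition A U L S T)
    {B : Finset (ι → ℚ)} (hB : B.card ≠ 2) : B ∈ L ↔ B ⊆ A ∧ IsTELace B := by
  constructor
  · intro hBL
    exact ⟨h.subset (by simp [hBL]), h.laces B hBL⟩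
  · rintro ⟨h1, h2⟩
    exact (h.mem_or_exists h1 h2).resolve_right fun ⟨_, _, _, h3⟩ => hB h3

theorem _root_.IsTEDecomposition.mem_thick_iff (h : IsTEDecomposition A U L S T)
    {B : Finset (ι → ℚ)} : B ∈ T ↔ B ∈ L ∪ S ∪ T ∧ IsThickTEInterlace B := by
  constructor
  · intro hB
    exact ⟨Finset.mem_union_right _ hB, h.thick B hB⟩
  · rintro ⟨h1, h2⟩
    simp only [Finset.mem_union] at h1
    rcases h1 with (h1 | h1) | h1
    · exact absurd (h.laces B h1) h2.not_isTELace
    · exact absurd (h.thin B h1) h2.not_isThin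
    · exact h1

theorem _root_.IsTEDecomposition.union_laces_thin (h : IsTEDecomposition A U L S T) :
    L ∪ S = (L ∪ S ∪ T) \ T := by
  rw [Finset.union_sdiff_right, Finset.sdiff_eq_self_of_disjoint]
  exact Finset.disjoint_union_left.2 ⟨h.disjoint_laces_thick, h.disjoint_thin_thick⟩

theorem _root_.IsTEDecomposition.tu_eq (h : IsTEDecomposition A U L S T) :
    U = A \ (L ∪ S ∪ T).sup id := by
  have hU : Disjoint U ((L ∪ S ∪ T).sup id) := by
    rw [Finset.disjoint_sup_right]
    intro B hB
    refine h.pairwiseDisjoint (Finset.mem_insert_self _ _) (Finset.mem_insert_of_mem hB) ?_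
    rintro rfl
    exact h.not_isTUSet hB h.tu
  have h1 := h.union_eq
  rw [Finset.sup_insert] at h1
  rw [← h1]
  exact (Finset.union_sdiff_cancel_right hU).symm

end Uniqueness

end Decomposition

end Equimod

open Equimod in
/-- For a linearly independent set `A` of `0, 1, -1` vectors: `A` is a te-set iff it is a disjoint
union of mutually-tu te-bricks; iff it has such a decomposition into one tu-set, te-laces, thin and
thick te-interlaces; and the decomposition is unique up to listing each brick of size two as a
te-lace or as a (thin) te-interlace. -/
theorem theorem3p4 {ι : Type*} [Fintype ι] (A : Finset (ι → ℚ)) (hA : IsIndepSignSet A) :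
    (IsTESet A ↔ ∃ F : Finset (Finset (ι → ℚ)), IsMutuallyTUPartition A F) ∧
    (IsTESet A ↔ ∃ (U : Finset (ι → ℚ)) (L S T : Finset (Finset (ι → ℚ))),
      IsTEDecomposition A U L S T) ∧
    (∀ (U : Finset (ι → ℚ)) (L S T : Finset (Finset (ι → ℚ))), IsTEDecomposition A U L S T →
      ∀ (U' : Finset (ι → ℚ)) (L' S' T' : Finset (Finset (ι → ℚ))),
        IsTEDecomposition A U' L' S' T' ↔
          U' = U ∧ T' = T ∧ L' ∪ S' = L ∪ S ∧ Disjoint L' S' ∧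
            ∀ B : Finset (ι → ℚ), B.card ≠ 2 → (B ∈ L' ↔ B ∈ L)) := by
  refine ⟨⟨fun h => ?_, fun ⟨F, hF⟩ => isTESet_of_partition hA hF⟩,
    ⟨exists_isTEDecomposition, fun ⟨U, L, S, T, h⟩ =>
      isTESet_of_partition hA h.isMutuallyTUPartition⟩, fun U L S T h U' L' S' T' => ?_⟩
  · obtain ⟨U, L, S, T, h⟩ := exists_isTEDecomposition h
    exact ⟨_, h.isMutuallyTUPartition⟩
  have hTE := isTESet_of_partition hA h.isMutuallyTUPartition
  constructor
  · intro h'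
    have h1 : L' ∪ S' ∪ T' = L ∪ S ∪ T :=
      Finset.ext fun B => (h'.mem_iff hTE B).trans (h.mem_iff hTE B).symm
    have h2 : T' = T := Finset.ext fun B => by rw [h'.mem_thick_iff, h.mem_thick_iff, h1]
    refine ⟨by rw [h'.tu_eq, h.tu_eq, h1], h2, ?_, h'.disjoint_laces_thin, fun B hB => ?_⟩
    · rw [h'.union_laces_thin, h.union_laces_thin, h1, h2]
    · rw [h'.mem_laces_iff hB, h.mem_laces_iff hB]
  · rintro ⟨rfl, rfl, h1, h2, h3⟩
    have h4 : ∀ B, B ∈ L' ∨ B ∈ S' ↔ B ∈ L ∨ B ∈ S := fun B => by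
      rw [← Finset.mem_union, h1, Finset.mem_union]
    have hd : Disjoint (L' ∪ S') T' := by
      rw [h1]
      exact Finset.disjoint_union_left.2 ⟨h.disjoint_laces_thick, h.disjoint_thin_thick⟩
    rw [Finset.disjoint_union_left] at hd
    refine ⟨h.tu, fun B hB => ?_, fun B hB => ?_, h.thick, h2, hd.1, hd.2, ?_, ?_, ?_⟩
    · by_cases hc : B.card = 2
      · rcases (h4 B).1 (Or.inl hB) with h5 | h5
        · exact h.laces B h5
        · exact (h.thin B h5).1.isTELace hc
      · exact h.laces B ((h3 B hc).1 hB)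
    · rcases (h4 B).1 (Or.inr hB) with h5 | h5
      · by_cases hc : B.card = 2
        · exact (h.laces B h5).isThinTEInterlace hc
        · exact absurd hB (Finset.disjoint_left.1 h2 ((h3 B hc).2 h5))
      · exact h.thin B h5
    · rw [h1]; exact h.pairwiseDisjoint
    · rw [h1]; exact h.union_eq
    · rw [h1]; exact h.mutuallyTU
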